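/- Let $d\ge 2$ and $0<s<\frac d2$. Let $\mathring{H}^{s}(\mathbb R^d)$ be the space of real functions $u\in L^{\frac{2d}{d-2s}}(\mathbb R^d)$ whose Fourier transform $\mathscr F[u]$ is a locally integrable function with $$\|u\|_{\mathring{H}^{s}}:=\Big(\int_{\mathbb R^d}|\xi|^{2s}|\mathscr F[u](\xi)|^2\,d\xi\Big)^{1/2}<\infty ,$$ where $\mathscr F[\varphi](\xi)=(2\pi)^{-d/2}\int_{\mathbb R^d}\varphi(x)e^{-ix\cdot\xi}\,dx$ for Schwartz functions $\varphi$, extended to tempered distributions, and let $\langle u,v\rangle_{\mathring H^s}=\int_{\mathbb R^d}|\xi|^{2s}\mathscr F[u](\xi)\overline{\mathscr F[v](\xi)}\,d\xi$. Let $\mathring{H}^{-s}(\mathbb R^d)$ be the dual space of $\mathring{H}^{s}(\mathbb R^d)$, with the dual norm. Put $$I_{2s}(x)=A_{2s}|x|^{2s-d},\qquad A_{2s}=\frac{\Gamma((d-2s)/2)}{\pi^{d/2}\,2^{2s}\,\Gamma(s)},\qquad \mathcal D_{2s}(f,f)=\int_{\mathbb R^d}(I_{2s}*f)(x)\,f(x)\,dx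 .$$ Let $q\in\big[\frac{2d}{d+2s},\infty\big]$ and let $T\in \mathring{H}^{-s}(\mathbb R^d)\cap L^q_{loc}(\mathbb R^d)$, that is, $T\in L^q_{loc}(\mathbb R^d)$ is a real function and there is an element of $\mathring{H}^{-s}(\mathbb R^d)$, also denoted by $T$, such that $\langle T,\varphi\rangle=\int_{\mathbb R^d} T(x)\varphi(x)\,dx$ for all $\varphi\in C^\infty_c(\mathbb R^d)$. Assume that $T\ge 0$ almost everywhere. Then there is a unique $U_T\in\mathring{H}^{s}(\mathbb R^d)$ with $\langle T,\varphi\rangle=\langle U_T,\varphi\rangle_{\mathring H^s}$ for all $\varphi\in\mathring{H}^{s}(\mathbb R^d)$; the integral $(I_{2s}*T)(x)$ converges absolutely for almost every $x$; and $$U_T=I_{2s}*T\quad\text{a.e. in }\mathbb R^d .$$ Moreover, $(I_{2s}*T)\,T\in L^1(\mathbb R^d)$ and $$\|T\|^2_{\mathring{H}^{-s}(\mathbb R^d)}=\mathcal D_{2s}(T,T).$$ -/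

import Mathlib

open MeasureTheory
open scoped FourierTransform SchwartzMap ENNReal ContDiff

noncomputable section

namespace RieszEnergy

/-- The exponent `2d/(d-2s)` of the Sobolev embedding. -/
def sobolevExponent (d : ℕ) (s : ℝ) : ℝ≥0∞ := ENNReal.ofReal (2 * d / (d - 2 * s))

/-- The symbol of `(-Δ)^s`. Mathlib's Fourier transform is
`û(ξ) = ∫ u(x) exp(-2πi x·ξ) dx`, so the multiplier is `(2π|ξ|)^{2s}`; by the change of variables
`ξ ↦ ξ/(2π)`, `∫ (2π|ξ|)^{2s} |û(ξ)|² dξ` equals `∫ |ξ|^{2s} |F[u](ξ)|² dξ` for the unitary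
transform `F[u](ξ) = (2π)^{-d/2} ∫ u(x) exp(-i x·ξ) dx`. -/
def symbol {d : ℕ} (s : ℝ) (ξ : EuclideanSpace ℝ (Fin d)) : ℝ := (2 * Real.pi * ‖ξ‖) ^ (2 * s)

/-- `w` is a locally integrable function, it is the Fourier transform of `u` in the sense of
tempered distributions, and `∫ (2π|ξ|)^{2s} |w(ξ)|² dξ < ∞`. -/
structure IsSobolevFourier {d : ℕ} (s : ℝ) (u : EuclideanSpace ℝ (Fin d) → ℝ)
    (w : EuclideanSpace ℝ (Fin d) → ℂ) : Prop where
  locallyIntegrable : LocallyIntegrable w volume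
  energy : Integrable (fun ξ => symbol s ξ * ‖w ξ‖ ^ 2) volume
  pairing : ∀ φ : 𝓢(EuclideanSpace ℝ (Fin d), ℂ),
    ∫ ξ, w ξ * φ ξ = ∫ x, (u x : ℂ) * (𝓕 φ) x

lemma symbol_nonneg {d : ℕ} (s : ℝ) (ξ : EuclideanSpace ℝ (Fin d)) : 0 ≤ symbol s ξ := by
  unfold symbol; positivity

lemma measurable_symbol {d : ℕ} (s : ℝ) :
    Measurable (symbol s : EuclideanSpace ℝ (Fin d) → ℝ) := by
  unfold symbol; fun_prop

lemma IsSobolevFourier.smul {d : ℕ} {s : ℝ} {u : EuclideanSpace ℝ (Fin d) → ℝ}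
    {w : EuclideanSpace ℝ (Fin d) → ℂ} (h : IsSobolevFourier s u w) (c : ℝ)
    {v : EuclideanSpace ℝ (Fin d) → ℝ} (hv : v =ᵐ[volume] fun x => c * u x) :
    IsSobolevFourier s v (fun ξ => (c : ℂ) * w ξ) where
  locallyIntegrable := h.locallyIntegrable.smul (c : ℂ)
  energy := by
    refine (h.energy.const_mul (c ^ 2)).congr (ae_of_all _ fun ξ => ?_)
    simp [mul_pow]; ring
  pairing φ := by
    have : ∫ x, (v x : ℂ) * (𝓕 φ) x = ∫ x, (c : ℂ) * ((u x : ℂ) * (𝓕 φ) x) := by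
      refine integral_congr_ae ?_
      filter_upwards [hv] with x hx
      rw [hx]; push_cast; ring
    rw [this, integral_const_mul, ← h.pairing φ, ← integral_const_mul]
    simp only [mul_assoc]

/-- A Fourier transform of finite energy may be multiplied by Schwartz functions. -/
lemma IsSobolevFourier.integrable_mul {d : ℕ} {s : ℝ} (hs : 0 < s)
    {u : EuclideanSpace ℝ (Fin d) → ℝ} {w : EuclideanSpace ℝ (Fin d) → ℂ}
    (h : IsSobolevFourier s u w) (φ : 𝓢(EuclideanSpace ℝ (Fin d), ℂ)) :
    Integrable (fun ξ => w ξ * φ ξ) volume := by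
  have hm : AEStronglyMeasurable (fun ξ => w ξ * φ ξ) volume :=
    h.locallyIntegrable.aestronglyMeasurable.mul φ.continuous.aestronglyMeasurable
  obtain ⟨C, hC⟩ : ∃ C, ∀ x, ‖φ x‖ ≤ C := ⟨_, φ.norm_le_seminorm ℝ⟩
  have hC0 : 0 ≤ C := (norm_nonneg _).trans (hC 0)
  rw [← integrableOn_univ, ← Set.union_compl_self (Metric.closedBall 0 1)]
  refine IntegrableOn.union ?_ ?_
  · have h1 := h.locallyIntegrable.integrableOn_isCompact
      (isCompact_closedBall (0 : EuclideanSpace ℝ (Fin d)) 1)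
    refine (h1.norm.const_mul C).mono' hm.restrict (ae_of_all _ fun ξ => ?_)
    rw [norm_mul, mul_comm]
    exact mul_le_mul_of_nonneg_right (hC ξ) (norm_nonneg _)
  · refine Integrable.mono' (g := fun ξ => ‖φ ξ‖ + C * (symbol s ξ * ‖w ξ‖ ^ 2))
      (Integrable.integrableOn (φ.integrable.norm.add (h.energy.const_mul C))) hm.restrict ?_
    refine (ae_restrict_iff' measurableSet_closedBall.compl).2 (ae_of_all _ fun ξ hξ => ?_)
    have h1 : 1 ≤ ‖ξ‖ := by
      by_contra! h'
      exact hξ (by simpa using h'.le)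
    have h2 : 1 ≤ symbol s ξ := by
      unfold symbol
      refine Real.one_le_rpow ?_ (by linarith)
      nlinarith [Real.pi_gt_three]
    rw [norm_mul]
    have h3 : ‖w ξ‖ ≤ 1 + ‖w ξ‖ ^ 2 := by nlinarith [sq_nonneg (‖w ξ‖ - 1)]
    calc ‖w ξ‖ * ‖φ ξ‖ ≤ (1 + ‖w ξ‖ ^ 2) * ‖φ ξ‖ := by gcongr
      _ = ‖φ ξ‖ + ‖φ ξ‖ * (1 * ‖w ξ‖ ^ 2) := by ring
      _ ≤ ‖φ ξ‖ + C * (symbol s ξ * ‖w ξ‖ ^ 2) := by gcongr; exact hC ξ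

/-- The Fourier transform is unique almost everywhere. -/
lemma IsSobolevFourier.ae_unique {d : ℕ} {s : ℝ}
    {u : EuclideanSpace ℝ (Fin d) → ℝ} {w w' : EuclideanSpace ℝ (Fin d) → ℂ}
    (h : IsSobolevFourier s u w) (h' : IsSobolevFourier s u w') : w =ᵐ[volume] w' := by
  refine ae_eq_of_integral_contDiff_smul_eq h.locallyIntegrable h'.locallyIntegrable ?_
  intro g hg hgc
  have hc : HasCompactSupport (fun x => (g x : ℂ)) := hgc.comp_left (g := fun t : ℝ => (t : ℂ)) rfl
  have hd : ContDiff ℝ ∞ (fun x => (g x : ℂ)) := Complex.ofRealCLM.contDiff.comp hg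
  have e1 := h.pairing (hc.toSchwartzMap hd)
  have e2 := h'.pairing (hc.toSchwartzMap hd)
  have := e1.trans e2.symm
  simpa [mul_comm] using! this

lemma sobolevExponent_ge_one {d : ℕ} {s : ℝ} (h : 0 < s ∧ s < (d : ℝ) / 2) :
    1 ≤ sobolevExponent d s := by
  unfold sobolevExponent
  rw [ENNReal.one_le_ofReal, le_div_iff₀] <;> linarith [h.1, h.2]

lemma integrable_mul_schwartz {d : ℕ} {p : ℝ≥0∞} (hp : 1 ≤ p)
    {u : EuclideanSpace ℝ (Fin d) → ℝ} (hu : MemLp u p volume)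
    (φ : 𝓢(EuclideanSpace ℝ (Fin d), ℂ)) : Integrable (fun x => (u x : ℂ) * φ x) volume := by
  have : p.HolderConjugate (ENNReal.conjExponent p) := .conjExponent hp
  exact MemLp.integrable_mul (p := p) (q := ENNReal.conjExponent p) hu.ofReal (φ.memLp _ _)

lemma IsSobolevFourier.integrable_add_energy {d : ℕ} {s : ℝ}
    {u v : EuclideanSpace ℝ (Fin d) → ℝ} {w z : EuclideanSpace ℝ (Fin d) → ℂ}
    (h : IsSobolevFourier s u w) (h' : IsSobolevFourier s v z) :
    Integrable (fun ξ => symbol s ξ * ‖w ξ + z ξ‖ ^ 2) volume := by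
  refine ((h.energy.const_mul 2).add (h'.energy.const_mul 2)).mono' ?_ (ae_of_all _ fun ξ => ?_)
  · exact (measurable_symbol s).aestronglyMeasurable.mul
      ((h.locallyIntegrable.aestronglyMeasurable.add
        h'.locallyIntegrable.aestronglyMeasurable).norm.pow 2)
  · have h0 := symbol_nonneg s ξ
    rw [Real.norm_of_nonneg (by positivity)]
    have h1 : ‖w ξ + z ξ‖ ^ 2 ≤ 2 * ‖w ξ‖ ^ 2 + 2 * ‖z ξ‖ ^ 2 := by
      have := norm_add_le (w ξ) (z ξ)
      nlinarith [norm_nonneg (w ξ + z ξ), sq_nonneg (‖w ξ‖ - ‖z ξ‖)]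
    calc symbol s ξ * ‖w ξ + z ξ‖ ^ 2 ≤ symbol s ξ * (2 * ‖w ξ‖ ^ 2 + 2 * ‖z ξ‖ ^ 2) := by gcongr
      _ = _ := by simp; ring

lemma IsSobolevFourier.add {d : ℕ} {s : ℝ} (hs : 0 < s ∧ s < (d : ℝ) / 2)
    {u v y : EuclideanSpace ℝ (Fin d) → ℝ} {w z : EuclideanSpace ℝ (Fin d) → ℂ}
    (hu : MemLp u (sobolevExponent d s) volume) (hv : MemLp v (sobolevExponent d s) volume)
    (hy : y =ᵐ[volume] fun x => u x + v x)
    (h : IsSobolevFourier s u w) (h' : IsSobolevFourier s v z) :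
    IsSobolevFourier s y (fun ξ => w ξ + z ξ) where
  locallyIntegrable := h.locallyIntegrable.add h'.locallyIntegrable
  energy := h.integrable_add_energy h'
  pairing φ := by
    have : ∫ x, (y x : ℂ) * (𝓕 φ) x = ∫ x, ((u x : ℂ) * (𝓕 φ) x + (v x : ℂ) * (𝓕 φ) x) := by
      refine integral_congr_ae ?_
      filter_upwards [hy] with x hx
      rw [hx]; push_cast; ring
    have hp := sobolevExponent_ge_one hs
    rw [this, integral_add (integrable_mul_schwartz hp hu _) (integrable_mul_schwartz hp hv _),
      ← h.pairing φ, ← h'.pairing φ,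
      ← integral_add (h.integrable_mul hs.1 φ) (h'.integrable_mul hs.1 φ)]
    simp only [add_mul]

/-- The real vector space of all (classes of) `u ∈ L^{2d/(d-2s)}(ℝ^d)` whose Fourier transform is a
function with `∫ (2π|ξ|)^{2s} |û(ξ)|² dξ < ∞`. -/
def homSobolevSubmodule (d : ℕ) (s : ℝ) [hs : Fact (0 < s ∧ s < (d : ℝ) / 2)] :
    Submodule ℝ (Lp ℝ (sobolevExponent d s) (volume : Measure (EuclideanSpace ℝ (Fin d)))) where
  carrier := {u | ∃ w, IsSobolevFourier s u w}
  zero_mem' := by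
    refine ⟨0, ?_, ?_, fun φ => ?_⟩
    · exact locallyIntegrable_zero
    · simp
    · have : ∫ x, (((0 : Lp ℝ (sobolevExponent d s)
          (volume : Measure (EuclideanSpace ℝ (Fin d)))) x : ℝ) : ℂ) * (𝓕 φ) x
          = ∫ x : EuclideanSpace ℝ (Fin d), (0 : ℂ) := by
        refine integral_congr_ae ?_
        filter_upwards [Lp.coeFn_zero ℝ (sobolevExponent d s)
          (volume : Measure (EuclideanSpace ℝ (Fin d)))] with x hx
        rw [hx]; simp
      rw [this]; simp
  add_mem' := by
    rintro u v ⟨w, hw⟩ ⟨z, hz⟩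
    exact ⟨_, hw.add hs.out (Lp.memLp u) (Lp.memLp v) (Lp.coeFn_add u v) hz⟩
  smul_mem' := by
    rintro c u ⟨w, hw⟩
    exact ⟨_, hw.smul c (Lp.coeFn_smul c u)⟩

/-- The homogeneous fractional Sobolev space `H̊^s(ℝ^d)` of real functions, `0 < s < d/2`. It is a
separate type because its norm is not the one of `L^{2d/(d-2s)}`. -/
def HomSobolev (d : ℕ) (s : ℝ) [Fact (0 < s ∧ s < (d : ℝ) / 2)] : Type :=
  homSobolevSubmodule d s

namespace HomSobolev

variable {d : ℕ} {s : ℝ} [hs : Fact (0 < s ∧ s < (d : ℝ) / 2)]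

instance : AddCommGroup (HomSobolev d s) :=
  inferInstanceAs (AddCommGroup (homSobolevSubmodule d s))

instance : Module ℝ (HomSobolev d s) := inferInstanceAs (Module ℝ (homSobolevSubmodule d s))

/-- The class in `L^{2d/(d-2s)}` of an element of `H̊^s`. -/
def toLp (u : HomSobolev d s) :
    Lp ℝ (sobolevExponent d s) (volume : Measure (EuclideanSpace ℝ (Fin d))) :=
  Subtype.val (p := fun f => f ∈ homSobolevSubmodule d s) u

lemma toLp_add (u v : HomSobolev d s) : (u + v).toLp = u.toLp + v.toLp := rfl

lemma toLp_smul (c : ℝ) (u : HomSobolev d s) : (c • u).toLp = c • u.toLp := rfl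

lemma toLp_injective : Function.Injective (toLp : HomSobolev d s → _) := Subtype.val_injective

instance : CoeFun (HomSobolev d s) (fun _ => EuclideanSpace ℝ (Fin d) → ℝ) :=
  ⟨fun u => (u.toLp : EuclideanSpace ℝ (Fin d) → ℝ)⟩

/-- The Fourier transform `û` of `u ∈ H̊^s`, a function determined almost everywhere. -/
def fourier (u : HomSobolev d s) : EuclideanSpace ℝ (Fin d) → ℂ :=
  Classical.choose (show ∃ w, IsSobolevFourier s u w from u.2)

lemma isSobolevFourier (u : HomSobolev d s) : IsSobolevFourier s u u.fourier :=
  Classical.choose_spec (show ∃ w, IsSobolevFourier s u w from u.2)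

lemma fourier_add (u v : HomSobolev d s) :
    (u + v).fourier =ᵐ[volume] fun ξ => u.fourier ξ + v.fourier ξ :=
  (u + v).isSobolevFourier.ae_unique
    (u.isSobolevFourier.add hs.out (Lp.memLp u.toLp) (Lp.memLp v.toLp)
      (Lp.coeFn_add u.toLp v.toLp) v.isSobolevFourier)

lemma fourier_smul (c : ℝ) (u : HomSobolev d s) :
    (c • u).fourier =ᵐ[volume] fun ξ => (c : ℂ) * u.fourier ξ :=
  (c • u).isSobolevFourier.ae_unique (u.isSobolevFourier.smul c (Lp.coeFn_smul c u.toLp))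

/-- The inner product `∫ (2π|ξ|)^{2s} û(ξ) conj(v̂(ξ)) dξ`. The functions are real, so the integral
is real and equal to the integral of the real part of the integrand. -/
def innerProd (u v : HomSobolev d s) : ℝ :=
  ∫ ξ, symbol s ξ * (u.fourier ξ * (starRingEnd ℂ) (v.fourier ξ)).re

lemma integrable_innerProd (u v : HomSobolev d s) :
    Integrable (fun ξ => symbol s ξ * (u.fourier ξ * (starRingEnd ℂ) (v.fourier ξ)).re)
      volume := by
  have hu := u.isSobolevFourier
  have hv := v.isSobolevFourier
  refine (hu.energy.add hv.energy).mono' ?_ (ae_of_all _ fun ξ => ?_)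
  · refine (measurable_symbol s).aestronglyMeasurable.mul ?_
    exact Complex.continuous_re.comp_aestronglyMeasurable
      (hu.locallyIntegrable.aestronglyMeasurable.mul
        (Complex.continuous_conj.comp_aestronglyMeasurable
          hv.locallyIntegrable.aestronglyMeasurable))
  · have h0 := symbol_nonneg s ξ
    rw [norm_mul, Real.norm_of_nonneg h0]
    have h1 : ‖(u.fourier ξ * (starRingEnd ℂ) (v.fourier ξ)).re‖
        ≤ ‖u.fourier ξ‖ ^ 2 + ‖v.fourier ξ‖ ^ 2 := by
      refine (Complex.abs_re_le_norm _).trans ?_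
      rw [norm_mul, RCLike.norm_conj]
      nlinarith [sq_nonneg (‖u.fourier ξ‖ - ‖v.fourier ξ‖), sq_nonneg (‖u.fourier ξ‖),
        sq_nonneg (‖v.fourier ξ‖)]
    calc _ ≤ symbol s ξ * (‖u.fourier ξ‖ ^ 2 + ‖v.fourier ξ‖ ^ 2) := by gcongr
      _ = _ := by simp; ring

lemma innerProd_self (u : HomSobolev d s) :
    innerProd u u = ∫ ξ, symbol s ξ * ‖u.fourier ξ‖ ^ 2 := by
  unfold innerProd
  congr 1
  ext ξ
  rw [Complex.mul_conj, Complex.ofReal_re, Complex.normSq_eq_norm_sq]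

lemma eq_zero_of_innerProd_self (u : HomSobolev d s) (h : innerProd u u = 0) : u = 0 := by
  have hd : 0 < d := by
    have := hs.out
    by_contra h0
    obtain rfl : d = 0 := by omega
    norm_num at this
    linarith [this.1, this.2]
  have : Nonempty (Fin d) := ⟨⟨0, hd⟩⟩
  have hU := u.isSobolevFourier
  rw [innerProd_self, integral_eq_zero_iff_of_nonneg
    (fun ξ => mul_nonneg (symbol_nonneg s ξ) (sq_nonneg _)) hU.energy] at h
  have hw : u.fourier =ᵐ[volume] 0 := by
    have h0 : ∀ᵐ ξ : EuclideanSpace ℝ (Fin d), ξ ≠ 0 := by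
      simp [ae_iff]
    filter_upwards [h, h0] with ξ hξ hξ0
    have : 0 < symbol s ξ := by
      have := norm_pos_iff.2 hξ0
      unfold symbol; positivity
    simpa [this.ne'] using hξ
  have hp := sobolevExponent_ge_one hs.out
  have key : ∀ φ : 𝓢(EuclideanSpace ℝ (Fin d), ℂ), ∫ x, (u x : ℂ) * φ x = 0 := by
    intro φ
    have := hU.pairing (𝓕⁻ φ)
    rw [FourierTransform.fourier_fourierInv_eq] at this
    rw [← this]
    rw [integral_congr_ae (g := fun _ => (0 : ℂ))]
    · simp
    · filter_upwards [hw] with ξ hξ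
      simp [hξ]
  have hz : ∀ᵐ x, u x = 0 := by
    refine ae_eq_zero_of_integral_contDiff_smul_eq_zero
      ((Lp.memLp u.toLp).locallyIntegrable hp) ?_
    intro g hg hgc
    have hc : HasCompactSupport (fun x => (g x : ℂ)) :=
      hgc.comp_left (g := fun t : ℝ => (t : ℂ)) rfl
    have hd : ContDiff ℝ ∞ (fun x => (g x : ℂ)) := Complex.ofRealCLM.contDiff.comp hg
    have e := key (hc.toSchwartzMap hd)
    have e' : ∫ x, ((u x * g x : ℝ) : ℂ) = 0 := by simpa using! e
    have e2 : ((∫ x, u x * g x : ℝ) : ℂ) = 0 := integral_ofReal.symm.trans e'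
    simpa [mul_comm] using! e2
  exact toLp_injective ((Lp.eq_zero_iff_ae_eq_zero).2 hz)

instance core : InnerProductSpace.Core ℝ (HomSobolev d s) where
  inner := innerProd
  conj_inner_symm u v := by
    change innerProd v u = innerProd u v
    unfold innerProd
    congr 1
    ext ξ
    simp only [Complex.mul_re, Complex.conj_re, Complex.conj_im]
    ring
  re_inner_nonneg u := by
    change 0 ≤ innerProd u u
    rw [innerProd_self]
    exact integral_nonneg fun ξ => mul_nonneg (symbol_nonneg s ξ) (sq_nonneg _)
  add_left u v y := by
    change innerProd (u + v) y = innerProd u y + innerProd v y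
    unfold innerProd
    rw [← integral_add (integrable_innerProd u y) (integrable_innerProd v y)]
    refine integral_congr_ae ?_
    filter_upwards [fourier_add u v] with ξ hξ
    rw [hξ, add_mul, Complex.add_re, mul_add]
  smul_left u v c := by
    change innerProd (c • u) v = c * innerProd u v
    unfold innerProd
    rw [← integral_const_mul]
    refine integral_congr_ae ?_
    filter_upwards [fourier_smul c u] with ξ hξ
    rw [hξ, mul_assoc, Complex.re_ofReal_mul]
    ring
  definite u h := eq_zero_of_innerProd_self u h

instance : NormedAddCommGroup (HomSobolev d s) := core.toNormedAddCommGroup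

instance : InnerProductSpace ℝ (HomSobolev d s) := InnerProductSpace.ofCore core.toCore

lemma inner_eq (u v : HomSobolev d s) : inner ℝ u v = innerProd u v := rfl

lemma norm_eq (u : HomSobolev d s) : ‖u‖ = √(∫ ξ, symbol s ξ * ‖u.fourier ξ‖ ^ 2) := by
  rw [← innerProd_self, ← inner_eq, real_inner_self_eq_norm_sq, Real.sqrt_sq (norm_nonneg _)]

/-- Real test functions have a Fourier transform of finite energy. -/
lemma isSobolevFourier_test {φ : EuclideanSpace ℝ (Fin d) → ℝ} (hφ : ContDiff ℝ ∞ φ)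
    (hc : HasCompactSupport φ) :
    IsSobolevFourier s φ (𝓕 (fun x => (φ x : ℂ))) := by
  have hc' : HasCompactSupport (fun x => (φ x : ℂ)) :=
    hc.comp_left (g := fun t : ℝ => (t : ℂ)) rfl
  have hd' : ContDiff ℝ ∞ (fun x => (φ x : ℂ)) := Complex.ofRealCLM.contDiff.comp hφ
  set F : 𝓢(EuclideanSpace ℝ (Fin d), ℂ) := hc'.toSchwartzMap hd' with hF
  have hw : 𝓕 (fun x => (φ x : ℂ)) = (𝓕 F : 𝓢(EuclideanSpace ℝ (Fin d), ℂ)) := rfl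
  rw [hw]
  refine ⟨((𝓕 F).integrable (μ := volume)).locallyIntegrable, ?_, fun ψ => ?_⟩
  · obtain ⟨C, hC⟩ : ∃ C, ∀ x, ‖(𝓕 F) x‖ ≤ C := ⟨_, (𝓕 F).norm_le_seminorm ℝ⟩
    obtain ⟨k, hk⟩ := exists_nat_ge (2 * s)
    have h0 := ((𝓕 F).integrable (μ := volume)).norm
    have h1 := (𝓕 F).integrable_pow_mul volume k
    refine ((h0.add (h1.const_mul ((2 * Real.pi) ^ k))).const_mul C).mono' ?_
      (ae_of_all _ fun ξ => ?_)
    · exact (measurable_symbol s).aestronglyMeasurable.mul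
        ((𝓕 F).continuous.aestronglyMeasurable.norm.pow 2)
    · have hs0 := symbol_nonneg s ξ
      rw [Real.norm_of_nonneg (by positivity)]
      have hsym : symbol s ξ ≤ 1 + (2 * Real.pi) ^ k * ‖ξ‖ ^ k := by
        rw [← mul_pow]
        unfold symbol
        have hy : 0 ≤ 2 * Real.pi * ‖ξ‖ := by positivity
        rcases le_total (2 * Real.pi * ‖ξ‖) 1 with h | h
        · have := Real.rpow_le_one hy h (by linarith [hs.out.1] : 0 ≤ 2 * s)
          have := pow_nonneg hy k
          linarith
        · have := Real.rpow_le_rpow_of_exponent_le h hk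
          rw [Real.rpow_natCast] at this
          linarith
      have hn := norm_nonneg ((𝓕 F) ξ)
      calc symbol s ξ * ‖(𝓕 F) ξ‖ ^ 2
          = ‖(𝓕 F) ξ‖ * (symbol s ξ * ‖(𝓕 F) ξ‖) := by ring
        _ ≤ C * ((1 + (2 * Real.pi) ^ k * ‖ξ‖ ^ k) * ‖(𝓕 F) ξ‖) := by
          gcongr
          · exact hn.trans (hC ξ)
          · exact hC ξ
        _ = _ := by simp only [Pi.add_apply]; ring
  · exact SchwartzMap.integral_fourier_mul_eq F ψ

/-- A test function `φ ∈ C_c^∞(ℝ^d)` as an element of `H̊^s(ℝ^d)`. -/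
def ofTest (φ : EuclideanSpace ℝ (Fin d) → ℝ) (hφ : ContDiff ℝ ∞ φ) (hc : HasCompactSupport φ) :
    HomSobolev d s :=
  ⟨(hφ.continuous.memLp_of_hasCompactSupport hc).toLp φ, 𝓕 (fun x => (φ x : ℂ)),
    { locallyIntegrable := (isSobolevFourier_test (s := s) hφ hc).locallyIntegrable
      energy := (isSobolevFourier_test (s := s) hφ hc).energy
      pairing := fun ψ => by
        rw [(isSobolevFourier_test (s := s) hφ hc).pairing ψ]
        refine integral_congr_ae ?_
        filter_upwards [(hφ.continuous.memLp_of_hasCompactSupport hc :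
          MemLp φ (sobolevExponent d s) volume).coeFn_toLp] with x hx
        rw [hx] }⟩

lemma ofTest_ae_eq (φ : EuclideanSpace ℝ (Fin d) → ℝ) (hφ : ContDiff ℝ ∞ φ)
    (hc : HasCompactSupport φ) : (ofTest φ hφ hc : HomSobolev d s) =ᵐ[volume] φ :=
  (hφ.continuous.memLp_of_hasCompactSupport hc :
    MemLp φ (sobolevExponent d s) volume).coeFn_toLp

end HomSobolev

/-- `f ∈ L^q_loc(ℝ^d)`. -/
def MemLqLoc {d : ℕ} (q : ℝ≥0∞) (f : EuclideanSpace ℝ (Fin d) → ℝ) : Prop :=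
  ∀ K : Set (EuclideanSpace ℝ (Fin d)), IsCompact K → MemLp f q (volume.restrict K)

/-- The element `T` of the dual space `H̊^{-s}` is the regular distribution given by the function
`t`: it acts on test functions by integration against `t`. -/
def IsRegularDistribution {d : ℕ} {s : ℝ} [Fact (0 < s ∧ s < (d : ℝ) / 2)]
    (T : StrongDual ℝ (HomSobolev d s)) (t : EuclideanSpace ℝ (Fin d) → ℝ) : Prop :=
  ∀ (φ : EuclideanSpace ℝ (Fin d) → ℝ) (hφ : ContDiff ℝ ∞ φ) (hc : HasCompactSupport φ),
    T (HomSobolev.ofTest φ hφ hc) = ∫ x, t x * φ x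

/-- `U` is the Riesz representative of `T`: `⟨T, φ⟩ = ⟨U, φ⟩_{H̊^s}` for all `φ ∈ H̊^s`. -/
def IsRieszRepresentative {d : ℕ} {s : ℝ} [Fact (0 < s ∧ s < (d : ℝ) / 2)]
    (T : StrongDual ℝ (HomSobolev d s)) (U : HomSobolev d s) : Prop :=
  ∀ φ : HomSobolev d s, T φ = inner ℝ U φ

/-- The Riesz kernel `I_α(x) = A_α |x|^{α-d}` with
`A_α = Γ((d-α)/2) / (π^{d/2} 2^α Γ(α/2))`. -/
def rieszKernel {d : ℕ} (α : ℝ) (x : EuclideanSpace ℝ (Fin d)) : ℝ :=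
  Real.Gamma ((d - α) / 2) / (Real.pi ^ ((d : ℝ) / 2) * 2 ^ α * Real.Gamma (α / 2))
    * ‖x‖ ^ (α - d)

/-- The Riesz potential `(I_α * f)(x) = ∫ I_α(x-y) f(y) dy`. -/
def rieszPotential {d : ℕ} (α : ℝ) (f : EuclideanSpace ℝ (Fin d) → ℝ)
    (x : EuclideanSpace ℝ (Fin d)) : ℝ :=
  ∫ y, rieszKernel α (x - y) * f y

/-- The Coulomb energy `D_α(f,g) = ∫ (I_α * f)(x) g(x) dx`. -/
def coulombEnergy {d : ℕ} (α : ℝ) (f g : EuclideanSpace ℝ (Fin d) → ℝ) : ℝ :=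
  ∫ x, rieszPotential α f x * g x

end RieszEnergy

end

/-!
The Riesz representative. `H̊^s` is complete: on the Fourier side it is a weighted `L²` space, so a
Cauchy sequence has a limit there, and the Sobolev inequality `exists_norm_toLp_le` makes the
functions themselves converge in `L^{2d/(d-2s)}`. The inequality follows from the splitting of `û`
at a frequency that depends on the level of `u`: the low frequencies are bounded by half the level,
Chebyshev and Plancherel control the high ones, and integration over the levels recovers
`∫ (2π|ξ|)^{2s} |û|²` (`volume_lt_norm_le`, `exists_lintegral_rpow_le`). Hence every `T` in the dual
has a unique representative `U`, and `F = (2π|ξ|)^{2s} Û` is the Fourier transform of `T`.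

The energy identity. Let `f ≥ 0` have a Fourier transform `F` of finite dual energy
(`IsDualFourier`), and let `g_r` be a fixed radial bump dilated to scale `r`. The integrals of `f`
against the translates of `g_r`, as a function of the translation, are the inverse Fourier transform
of `F 𝓕⁻ g_r`: only test functions, never noncompactly supported ones, are paired with `f`.
Plancherel's theorem at each `r`, followed by integration over `r` against `r^{2s-2d-1} dr`, gives
by Tonelli alone
`∫∫ f(x) f(y) H(x - y) dx dy = ∫ |F(ξ)|² J(ξ) dξ`,
where `H` and `J` are radial and homogeneous of degrees `2s - d` and `-2s`, hence multiples of
`|x|^{2s-d}` and `|ξ|^{-2s}` (`spatialProfile_eq`, `freqProfile_eq`). The ratio of the two constants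
is found by taking the Gaussian `exp (-π|x|²)`, its own Fourier transform, for `f`. The result is
`IsDualFourier.lintegral_rieszKernel`: the Riesz energy of `f` equals `∫ (2π|ξ|)^{-2s} |F|²`.

Conclusion. For `f = T` the identity says `D(T, T) = ‖U‖² = ‖T‖²`. Polarizing it between `T` and a
nonnegative test function `ψ` (`linteraction_test`) gives `∫ (I_{2s} * T) ψ = ∫ U ψ`, so
`I_{2s} * T` is finite almost everywhere and equals `U`. Positivity of `T` is what allows every
interchange of integrals without a bound known in advance.
-/

noncomputable section

namespace RieszEnergy

open FourierTransform ComplexConjugate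

variable {d : ℕ}

local notation "𝔼" => EuclideanSpace ℝ (Fin d)

/-! ### The Fourier transform on `L¹` and `L²` -/

lemma lintegral_enorm_sq (f : 𝔼 → ℂ) : ∫⁻ x, ‖f x‖ₑ ^ 2 = eLpNorm f 2 volume ^ 2 := by
  rw [eLpNorm_eq_lintegral_rpow_enorm_toReal two_ne_zero ENNReal.ofNat_ne_top,
    ← ENNReal.rpow_natCast, ← ENNReal.rpow_mul]
  simp

/-- Locally integrable functions that define the same tempered distribution agree. -/
lemma ae_eq_of_schwartz {f g : 𝔼 → ℂ} (hf : LocallyIntegrable f volume)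
    (hg : LocallyIntegrable g volume) (h : ∀ φ : 𝓢(𝔼, ℂ), ∫ x, f x * φ x = ∫ x, g x * φ x) :
    f =ᵐ[volume] g := by
  refine ae_eq_of_integral_contDiff_smul_eq hf hg fun χ hχ hc => ?_
  have hc' : HasCompactSupport (fun x => (χ x : ℂ)) :=
    hc.comp_left (g := fun t : ℝ => (t : ℂ)) rfl
  have := h (hc'.toSchwartzMap (Complex.ofRealCLM.contDiff.comp hχ))
  simpa [mul_comm] using! this

/-- The inverse Fourier transform on `L²`, characterized by its pairing with Schwartz functions. -/
lemma exists_fourierInv_of_memLp_two {w : 𝔼 → ℂ} (hw : MemLp w 2 volume) :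
    ∃ h : 𝔼 → ℂ, MemLp h 2 volume ∧ eLpNorm h 2 volume = eLpNorm w 2 volume ∧
      ∀ φ : 𝓢(𝔼, ℂ), ∫ ξ, w ξ * φ ξ = ∫ x, h x * (𝓕 φ) x := by
  set W : Lp ℂ 2 (volume : Measure 𝔼) := hw.toLp w with hW
  refine ⟨(𝓕⁻ W : Lp ℂ 2 (volume : Measure 𝔼)), Lp.memLp _, ?_, fun φ => ?_⟩
  · have h1 : ‖(𝓕⁻ W : Lp ℂ 2 (volume : Measure 𝔼))‖ = ‖W‖ :=
      (Lp.fourierTransformₗᵢ 𝔼 ℂ).symm.norm_map W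
    have h2 : ‖(𝓕⁻ W : Lp ℂ 2 (volume : Measure 𝔼))‖ₑ = ‖W‖ₑ := by
      rw [← ofReal_norm, ← ofReal_norm, h1]
    rw [Lp.enorm_def, Lp.enorm_def] at h2
    rw [h2, eLpNorm_congr_ae hw.coeFn_toLp]
  · have h1 := congrArg (fun T => T (𝓕 φ)) (Lp.fourierInv_toTemperedDistribution_eq W)
    simp only [TemperedDistribution.fourierInv_apply, Lp.toTemperedDistribution_apply,
      FourierTransform.fourierInv_fourier_eq, smul_eq_mul] at h1
    simp_rw [mul_comm (_ : ℂ) ((𝓕 φ : 𝓢(𝔼, ℂ)) _), ← h1]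
    refine integral_congr_ae ?_
    filter_upwards [hw.coeFn_toLp] with x hx
    rw [hx, mul_comm]

lemma integral_fourier_mul_eq {F G : 𝔼 → ℂ} (hF : Integrable F volume)
    (hG : Integrable G volume) : ∫ ξ, (𝓕 F) ξ * G ξ = ∫ x, F x * (𝓕 G) x := by
  simpa using! VectorFourier.integral_bilin_fourierIntegral_eq_flip (ContinuousLinearMap.mul ℂ ℂ)
    (L := innerₗ 𝔼) Real.continuous_fourierChar continuous_inner hF hG

lemma integral_fourierInv_mul_eq {F G : 𝔼 → ℂ} (hF : Integrable F volume)
    (hG : Integrable G volume) : ∫ ξ, (𝓕⁻ F) ξ * G ξ = ∫ x, F x * (𝓕⁻ G) x := by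
  have h := integral_fourier_mul_eq hF hG.comp_neg
  rw [← Real.fourierInv_eq_fourier_comp_neg] at h
  rw [← h, ← integral_neg_eq_self]
  simp [Real.fourierInv_eq_fourier_neg]

lemma integral_mul_eq_integral_fourierInv_mul {F : 𝔼 → ℂ} (hF : Integrable F volume)
    (φ : 𝓢(𝔼, ℂ)) : ∫ ξ, F ξ * φ ξ = ∫ x, (𝓕⁻ F) x * (𝓕 φ) x := by
  rw [integral_fourierInv_mul_eq hF (𝓕 φ : 𝓢(𝔼, ℂ)).integrable, ← SchwartzMap.fourierInv_coe,
    FourierTransform.fourierInv_fourier_eq]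

lemma continuous_fourier {F : 𝔼 → ℂ} (hF : Integrable F volume) : Continuous (𝓕 F) :=
  VectorFourier.fourierIntegral_continuous Real.continuous_fourierChar continuous_inner hF

lemma continuous_fourierInv {F : 𝔼 → ℂ} (hF : Integrable F volume) : Continuous (𝓕⁻ F) := by
  rw [Real.fourierInv_eq_fourier_comp_neg]
  exact continuous_fourier hF.comp_neg

/-- Plancherel's theorem for the Fourier integral of a function in `L¹ ∩ L²`. -/
lemma lintegral_enorm_fourierInv_sq {F : 𝔼 → ℂ} (hF : Integrable F volume)
    (hF2 : MemLp F 2 volume) :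
    ∫⁻ x, ‖(𝓕⁻ F) x‖ₑ ^ 2 = ∫⁻ ξ, ‖F ξ‖ₑ ^ 2 := by
  obtain ⟨h, hh, hn, hp⟩ := exists_fourierInv_of_memLp_two hF2
  have hae : h =ᵐ[volume] 𝓕⁻ F := by
    refine ae_eq_of_schwartz (hh.locallyIntegrable one_le_two)
      (continuous_fourierInv hF).locallyIntegrable fun φ => ?_
    have h1 := hp (𝓕⁻ φ)
    rw [integral_mul_eq_integral_fourierInv_mul hF] at h1
    rw [FourierTransform.fourier_fourierInv_eq] at h1
    exact h1.symm
  rw [lintegral_enorm_sq, lintegral_enorm_sq, ← hn, eLpNorm_congr_ae hae]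

/-! ### Splitting into low and high frequencies -/

lemma pos_of_lt_half {s : ℝ} (hs : 0 < s ∧ s < (d : ℝ) / 2) : 0 < d := by
  rcases Nat.eq_zero_or_pos d with rfl | h
  · have := hs.1.trans hs.2
    simp at this
  · exact h

lemma symbol_pos {s : ℝ} {ξ : 𝔼} (h : ξ ≠ 0) : 0 < symbol s ξ := by
  have := norm_pos_iff.2 h
  unfold symbol; positivity

lemma ae_ne_zero_of_pos (hd : 0 < d) : ∀ᵐ ξ : 𝔼, ξ ≠ 0 := by
  have : Nonempty (Fin d) := ⟨⟨0, hd⟩⟩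
  simp [ae_iff]

/-- The inverse symbol on a ball is a radial function, in the form needed for polar coordinates. -/
lemma symbol_inv_eq_indicator {s : ℝ} (A : ℝ) :
    (Metric.closedBall (0 : 𝔼) A).indicator (fun ξ => (symbol s ξ)⁻¹) =
      fun ξ => (Set.Iic A).indicator (fun y : ℝ => ((2 * Real.pi * y) ^ (2 * s))⁻¹) ‖ξ‖ := by
  ext ξ
  simp [Set.indicator, symbol]

/-- Near the origin `(2π|ξ|)^{-2s}` is integrable because `2s < d`. -/
lemma integral_symbol_inv_closedBall {s : ℝ} (hs : 0 < s ∧ s < (d : ℝ) / 2) {A : ℝ} (hA : 0 ≤ A) :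
    IntegrableOn (fun ξ : 𝔼 => (symbol s ξ)⁻¹) (Metric.closedBall 0 A) volume ∧
    ∫ ξ in Metric.closedBall (0 : 𝔼) A, (symbol s ξ)⁻¹ =
      (d * volume.real (Metric.ball (0 : 𝔼) 1) * (2 * Real.pi) ^ (-(2 * s)) / (d - 2 * s)) *
        A ^ ((d : ℝ) - 2 * s) := by
  have hd := pos_of_lt_half hs
  have : Nonempty (Fin d) := ⟨⟨0, hd⟩⟩
  have hlt : -1 < (d : ℝ) - 1 - 2 * s := by linarith [hs.2]
  have key : ∀ y ∈ Set.Ioi (0 : ℝ), y ^ (Module.finrank ℝ 𝔼 - 1) •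
      (Set.Iic A).indicator (fun y : ℝ => ((2 * Real.pi * y) ^ (2 * s))⁻¹) y =
      (Set.Ioc 0 A).indicator
        (fun y : ℝ => (2 * Real.pi) ^ (-(2 * s)) * y ^ ((d : ℝ) - 1 - 2 * s)) y := by
    intro y hy
    have hy' : 0 < y := hy
    have hyd : y ^ (Module.finrank ℝ 𝔼 - 1) = y ^ ((d : ℝ) - 1) := by
      rw [finrank_euclideanSpace_fin, ← Real.rpow_natCast, Nat.cast_sub hd, Nat.cast_one]
    by_cases h : y ≤ A
    · rw [Set.indicator_of_mem (show y ∈ Set.Iic A from h),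
        Set.indicator_of_mem (show y ∈ Set.Ioc 0 A from ⟨hy', h⟩), hyd, smul_eq_mul,
        Real.mul_rpow (by positivity) hy'.le, Real.rpow_sub hy' ((d : ℝ) - 1),
        Real.rpow_neg (by positivity)]
      field_simp
    · rw [Set.indicator_of_notMem (by exact h), Set.indicator_of_notMem (fun h' => h h'.2),
        smul_zero]
  have hint : IntervalIntegrable (fun y : ℝ => (2 * Real.pi) ^ (-(2 * s)) *
      y ^ ((d : ℝ) - 1 - 2 * s)) volume 0 A :=
    (intervalIntegral.intervalIntegrable_rpow' hlt).const_mul _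
  constructor
  · rw [← integrable_indicator_iff measurableSet_closedBall, symbol_inv_eq_indicator,
      integrable_fun_norm_addHaar, integrableOn_congr_fun key measurableSet_Ioi]
    refine Integrable.integrableOn ?_
    rw [integrable_indicator_iff measurableSet_Ioc]
    exact (intervalIntegrable_iff_integrableOn_Ioc_of_le hA).1 hint
  · rw [← integral_indicator measurableSet_closedBall, symbol_inv_eq_indicator,
      integral_fun_norm_addHaar volume
        ((Set.Iic A).indicator (fun y : ℝ => ((2 * Real.pi * y) ^ (2 * s))⁻¹)),
      setIntegral_congr_fun measurableSet_Ioi key, setIntegral_indicator measurableSet_Ioc,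
      Set.inter_eq_self_of_subset_right Set.Ioc_subset_Ioi_self,
      ← intervalIntegral.integral_of_le hA, intervalIntegral.integral_const_mul,
      integral_rpow (Or.inl hlt), Real.zero_rpow (by linarith)]
    have : (d : ℝ) - 2 * s ≠ 0 := by linarith [hs.2]
    rw [show (d : ℝ) - 1 - 2 * s + 1 = d - 2 * s by ring]
    simp
    field_simp

/-- The constant of the low-frequency estimate: `∫_{|ξ| ≤ A} (2π|ξ|)^{-2s} dξ` is this
constant times `A ^ (d - 2s)`. -/
def lowFreqConst (d : ℕ) (s : ℝ) : ℝ :=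
  d * volume.real (Metric.ball (0 : EuclideanSpace ℝ (Fin d)) 1) * (2 * Real.pi) ^ (-(2 * s)) /
    (d - 2 * s)

lemma lowFreqConst_pos {s : ℝ} (hs : 0 < s ∧ s < (d : ℝ) / 2) : 0 < lowFreqConst d s := by
  have hd := pos_of_lt_half hs
  have h1 : 0 < (d : ℝ) - 2 * s := by linarith [hs.2]
  have h2 : 0 < volume.real (Metric.ball (0 : EuclideanSpace ℝ (Fin d)) 1) :=
    ENNReal.toReal_pos (Metric.measure_ball_pos _ _ one_pos).ne' measure_ball_lt_top.ne
  unfold lowFreqConst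
  positivity

lemma lowFreq_integrable {s : ℝ}
    {u : 𝔼 → ℝ} {w : 𝔼 → ℂ} (h : IsSobolevFourier s u w) (A : ℝ) :
    Integrable ((Metric.closedBall (0 : 𝔼) A).indicator w) volume :=
  (integrable_indicator_iff measurableSet_closedBall).2
    (h.locallyIntegrable.integrableOn_isCompact (isCompact_closedBall _ _))

/-- By the Cauchy-Schwarz inequality the frequencies up to `A` of a function of energy at most one
contribute a bounded function. -/
lemma norm_fourierInv_lowFreq_le {s : ℝ} (hs : 0 < s ∧ s < (d : ℝ) / 2)
    {u : 𝔼 → ℝ} {w : 𝔼 → ℂ} (h : IsSobolevFourier s u w)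
    (hE : ∫ ξ, symbol s ξ * ‖w ξ‖ ^ 2 ≤ 1) {A : ℝ} (hA : 0 < A) (x : 𝔼) :
    ‖(𝓕⁻ ((Metric.closedBall (0 : 𝔼) A).indicator w)) x‖ ≤
      √(lowFreqConst d s * A ^ ((d : ℝ) - 2 * s)) := by
  obtain ⟨hi, hv⟩ := integral_symbol_inv_closedBall hs hA.le
  have hd := pos_of_lt_half hs
  set m := √(lowFreqConst d s * A ^ ((d : ℝ) - 2 * s)) with hm
  have hc := lowFreqConst_pos hs
  have hm0 : 0 < m := Real.sqrt_pos.2 (by positivity)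
  have hm2 : m ^ 2 = lowFreqConst d s * A ^ ((d : ℝ) - 2 * s) := Real.sq_sqrt (by positivity)
  change _ = lowFreqConst d s * _ at hv
  have hwi := h.locallyIntegrable.integrableOn_isCompact (isCompact_closedBall (0 : 𝔼) A)
  calc ‖(𝓕⁻ ((Metric.closedBall (0 : 𝔼) A).indicator w)) x‖
      ≤ ∫ ξ, ‖(Metric.closedBall (0 : 𝔼) A).indicator w ξ‖ :=
        VectorFourier.norm_fourierIntegral_le_integral_norm _ _ _ _ _
    _ = ∫ ξ in Metric.closedBall (0 : 𝔼) A, ‖w ξ‖ := by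
        simp_rw [norm_indicator_eq_indicator_norm]
        rw [integral_indicator measurableSet_closedBall]
    _ ≤ ∫ ξ in Metric.closedBall (0 : 𝔼) A,
          (m / 2 * (symbol s ξ * ‖w ξ‖ ^ 2) + m⁻¹ / 2 * (symbol s ξ)⁻¹) := by
        refine integral_mono_ae hwi.norm
          ((h.energy.integrableOn.const_mul _).add (hi.const_mul _)) ?_
        filter_upwards [ae_restrict_of_ae (ae_ne_zero_of_pos hd)] with ξ hξ
        have hsy := symbol_pos (s := s) hξ
        -- `2ab ≤ a² + b²` with `a² = m symbol ‖w‖²` and `b² = (m symbol)⁻¹`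
        have e : m / 2 * (symbol s ξ * ‖w ξ‖ ^ 2) + m⁻¹ / 2 * (symbol s ξ)⁻¹ - ‖w ξ‖
            = (m * symbol s ξ * ‖w ξ‖ - 1) ^ 2 / (2 * m * symbol s ξ) := by
          field_simp
          ring
        have : 0 ≤ (m * symbol s ξ * ‖w ξ‖ - 1) ^ 2 / (2 * m * symbol s ξ) := by positivity
        linarith
    _ = m / 2 * (∫ ξ in Metric.closedBall (0 : 𝔼) A, symbol s ξ * ‖w ξ‖ ^ 2) +
          m⁻¹ / 2 * m ^ 2 := by
        rw [integral_add (h.energy.integrableOn.const_mul _) (hi.const_mul _),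
          integral_const_mul, integral_const_mul, hv, hm2]
    _ ≤ m / 2 * 1 + m⁻¹ / 2 * m ^ 2 := by
        gcongr
        refine (setIntegral_le_integral h.energy ?_).trans hE
        exact ae_of_all _ fun ξ => mul_nonneg (symbol_nonneg s ξ) (sq_nonneg _)
    _ = m := by field_simp; ring

lemma highFreq_memLp {s : ℝ} (hs : 0 < s) {u : 𝔼 → ℝ} {w : 𝔼 → ℂ} (h : IsSobolevFourier s u w)
    {A : ℝ} (hA : 0 < A) :
    MemLp ((Metric.closedBall (0 : 𝔼) A)ᶜ.indicator w) 2 volume := by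
  have hm : AEStronglyMeasurable ((Metric.closedBall (0 : 𝔼) A)ᶜ.indicator w) volume :=
    h.locallyIntegrable.aestronglyMeasurable.indicator measurableSet_closedBall.compl
  rw [memLp_two_iff_integrable_sq_norm hm]
  refine (h.energy.const_mul ((2 * Real.pi * A) ^ (2 * s))⁻¹).mono' (hm.norm.pow 2)
    (ae_of_all _ fun ξ => ?_)
  rw [Real.norm_of_nonneg (sq_nonneg _)]
  have h0 := symbol_nonneg s ξ
  by_cases hξ : ξ ∈ (Metric.closedBall (0 : 𝔼) A)ᶜ
  · rw [Set.indicator_of_mem hξ]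
    have h1 : A ≤ ‖ξ‖ := by
      have : A < ‖ξ‖ := by simpa using hξ
      exact this.le
    have h2 : (2 * Real.pi * A) ^ (2 * s) ≤ symbol s ξ := by
      unfold symbol; gcongr
    have h3 : 0 < (2 * Real.pi * A) ^ (2 * s) := by positivity
    rw [← div_eq_inv_mul, le_div_iff₀ h3, mul_comm]
    gcongr
  · rw [Set.indicator_of_notMem hξ]
    simp only [norm_zero, ne_eq, OfNat.ofNat_ne_zero, not_false_eq_true, zero_pow]
    positivity

lemma locallyIntegrable_ofReal {u : 𝔼 → ℝ} (hu : LocallyIntegrable u volume) :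
    LocallyIntegrable (fun x => (u x : ℂ)) volume := fun x => by
  obtain ⟨K, hK, hi⟩ := hu x
  exact ⟨K, hK, hi.ofReal⟩

/-- Splitting `û` at a frequency `A` for which the low-frequency part of `u` is at most `r / 2`,
Chebyshev's inequality for the high-frequency part controls the level set `{|u| > r}`. -/
lemma volume_lt_norm_le {s : ℝ} (hs : 0 < s ∧ s < (d : ℝ) / 2)
    {u : 𝔼 → ℝ} {w : 𝔼 → ℂ} (hu : LocallyIntegrable u volume) (h : IsSobolevFourier s u w)
    (hE : ∫ ξ, symbol s ξ * ‖w ξ‖ ^ 2 ≤ 1) {A r : ℝ} (hA : 0 < A) (hr : 0 < r)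
    (hAr : √(lowFreqConst d s * A ^ ((d : ℝ) - 2 * s)) ≤ r / 2) :
    volume {x | r < ‖u x‖} ≤
      ENNReal.ofReal (4 / r ^ 2) * ∫⁻ ξ in (Metric.closedBall (0 : 𝔼) A)ᶜ, ‖w ξ‖ₑ ^ 2 := by
  have hlow := lowFreq_integrable h A
  obtain ⟨g, hg, hgn, hgp⟩ := exists_fourierInv_of_memLp_two (highFreq_memLp hs.1 h hA)
  have hc := continuous_fourierInv hlow
  have hsplit : (fun x => (u x : ℂ)) =ᵐ[volume]
      fun x => (𝓕⁻ ((Metric.closedBall (0 : 𝔼) A).indicator w)) x + g x := by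
    refine ae_eq_of_schwartz (locallyIntegrable_ofReal hu)
      (hc.locallyIntegrable.add (hg.locallyIntegrable one_le_two)) fun φ => ?_
    have h1 := h.pairing (𝓕⁻ φ)
    have h2 := hgp (𝓕⁻ φ)
    have h3 := integral_mul_eq_integral_fourierInv_mul hlow (𝓕⁻ φ)
    rw [FourierTransform.fourier_fourierInv_eq] at h1 h2 h3
    rw [← h1]
    simp only [add_mul]
    have hb : ∀ x, ‖(𝓕⁻ ((Metric.closedBall (0 : 𝔼) A).indicator w)) x‖ ≤ r / 2 := fun x =>
      (norm_fourierInv_lowFreq_le hs h hE hA x).trans hAr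
    have i1 : Integrable (fun x => (𝓕⁻ ((Metric.closedBall (0 : 𝔼) A).indicator w)) x * φ x) :=
      φ.integrable.bdd_mul hc.aestronglyMeasurable (ae_of_all _ hb)
    have i2 : Integrable (fun x => g x * φ x) := hg.integrable_mul (φ.memLp 2 _)
    rw [integral_add i1 i2, ← h2, ← h3, ← integral_add]
    · congr 1
      ext ξ
      rw [← add_mul, ← Pi.add_apply, Set.indicator_self_add_compl]
    · obtain ⟨C, hC⟩ : ∃ C, ∀ x, ‖(𝓕⁻ φ : 𝓢(𝔼, ℂ)) x‖ ≤ C := ⟨_, (𝓕⁻ φ).norm_le_seminorm ℝ⟩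
      exact hlow.mul_bdd (𝓕⁻ φ : 𝓢(𝔼, ℂ)).continuous.aestronglyMeasurable (ae_of_all _ hC)
    · exact (highFreq_memLp hs.1 h hA).integrable_mul ((𝓕⁻ φ : 𝓢(𝔼, ℂ)).memLp 2 _)
  calc volume {x | r < ‖u x‖} ≤ volume {x | ENNReal.ofReal (r ^ 2 / 4) ≤ ‖g x‖ₑ ^ 2} := by
        refine measure_mono_ae ?_
        filter_upwards [hsplit] with x hx hrx
        have hrx' : r < ‖u x‖ := hrx
        have h1 := norm_add_le ((𝓕⁻ ((Metric.closedBall (0 : 𝔼) A).indicator w)) x) (g x)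
        rw [← hx, Complex.norm_real] at h1
        have h2 := (norm_fourierInv_lowFreq_le hs h hE hA x).trans hAr
        have h3 : r / 2 ≤ ‖g x‖ := by linarith
        change ENNReal.ofReal (r ^ 2 / 4) ≤ ‖g x‖ₑ ^ 2
        rw [← ofReal_norm, ← ENNReal.ofReal_pow (norm_nonneg _)]
        refine ENNReal.ofReal_le_ofReal ?_
        nlinarith
    _ ≤ (∫⁻ x, ‖g x‖ₑ ^ 2) / ENNReal.ofReal (r ^ 2 / 4) :=
        meas_ge_le_lintegral_div (hg.aestronglyMeasurable.enorm.pow_const 2)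
          (ENNReal.ofReal_pos.2 (by positivity)).ne' ENNReal.ofReal_ne_top
    _ = ENNReal.ofReal (4 / r ^ 2) * ∫⁻ ξ in (Metric.closedBall (0 : 𝔼) A)ᶜ, ‖w ξ‖ₑ ^ 2 := by
        have e3 : ∫⁻ ξ, ‖(Metric.closedBall (0 : 𝔼) A)ᶜ.indicator w ξ‖ₑ ^ 2 =
            ∫⁻ ξ in (Metric.closedBall (0 : 𝔼) A)ᶜ, ‖w ξ‖ₑ ^ 2 := by
          rw [← lintegral_indicator measurableSet_closedBall.compl]
          refine lintegral_congr fun ξ => ?_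
          by_cases hξ : ξ ∈ (Metric.closedBall (0 : 𝔼) A)ᶜ
          · rw [Set.indicator_of_mem hξ, Set.indicator_of_mem hξ]
          · rw [Set.indicator_of_notMem hξ, Set.indicator_of_notMem hξ]; simp
        rw [lintegral_enorm_sq, hgn, ← lintegral_enorm_sq, e3, ENNReal.div_eq_inv_mul,
          ← ENNReal.ofReal_inv_of_pos (by positivity), inv_div]

/-! ### The Sobolev inequality -/

/-- The Sobolev inequality on the unit ball of `H̊^s`. In the layer-cake formula for `∫ |u|^p`, the
level `r` is estimated by `volume_lt_norm_le` at the frequency `A` with `A ^ γ = r / κ`. Exchanging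
the integrals over `r` and `ξ` leaves `∫ r^{p-3} dr` over `r < κ |ξ|^γ`, a multiple of
`|ξ|^{γ (p - 2)} = |ξ|^{2s}`. -/
lemma exists_lintegral_rpow_le {s : ℝ} (hs : 0 < s ∧ s < (d : ℝ) / 2) :
    ∃ C : ℝ≥0∞, C ≠ ⊤ ∧ ∀ (u : 𝔼 → ℝ) (w : 𝔼 → ℂ), LocallyIntegrable u volume →
      IsSobolevFourier s u w → ∫ ξ, symbol s ξ * ‖w ξ‖ ^ 2 ≤ 1 →
      ∫⁻ x, ENNReal.ofReal (‖u x‖ ^ (2 * (d : ℝ) / (d - 2 * s))) ≤ C := by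
  have hd := pos_of_lt_half hs
  have hd' : (0 : ℝ) < d := by exact_mod_cast hd
  have hds : 0 < (d : ℝ) - 2 * s := by linarith [hs.2]
  set γ : ℝ := ((d : ℝ) - 2 * s) / 2 with hγ
  have hγ0 : 0 < γ := by positivity
  set P : ℝ := 2 * (d : ℝ) / (d - 2 * s) with hP
  have hP2 : 2 < P := by rw [hP, lt_div_iff₀ hds]; linarith
  have hPγ : γ * (P - 2) = 2 * s := by rw [hγ, hP]; field_simp; ring
  set c := lowFreqConst d s with hc
  have hc0 : 0 < c := lowFreqConst_pos hs
  set κ : ℝ := 2 * √c with hκ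
  have hκ0 : 0 < κ := by have := Real.sqrt_pos.2 hc0; positivity
  set K : ℝ := 4 * κ ^ (P - 2) / (P - 2) * (2 * Real.pi) ^ (-(2 * s)) with hK
  refine ⟨ENNReal.ofReal P * (ENNReal.ofReal K * 1), by finiteness, fun u w hu h hE => ?_⟩
  rw [lintegral_rpow_eq_lintegral_meas_lt_mul _ (ae_of_all _ fun x => norm_nonneg _)
    hu.aestronglyMeasurable.norm.aemeasurable (by linarith)]
  gcongr
  have hwm : AEMeasurable (fun ξ => ‖w ξ‖ₑ ^ 2) volume :=
    h.locallyIntegrable.aestronglyMeasurable.enorm.pow_const 2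
  set S : Set (ℝ × 𝔼) := {q | q.1 < κ * ‖q.2‖ ^ γ} with hS
  have hSm : MeasurableSet S := measurableSet_lt measurable_fst (by fun_prop)
  calc ∫⁻ r in Set.Ioi (0 : ℝ), volume {x | r < ‖u x‖} * ENNReal.ofReal (r ^ (P - 1))
      ≤ ∫⁻ r in Set.Ioi (0 : ℝ), ∫⁻ ξ, S.indicator
          (fun q => ENNReal.ofReal (4 * q.1 ^ (P - 3)) * ‖w q.2‖ₑ ^ 2) (r, ξ) := by
        refine setLIntegral_mono' measurableSet_Ioi fun r hr => ?_
        have hr0 : 0 < r := hr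
        set A : ℝ := (r / κ) ^ γ⁻¹ with hA
        have hA0 : 0 < A := by positivity
        have hAγ : A ^ γ = r / κ := Real.rpow_inv_rpow (by positivity) hγ0.ne'
        have hAr : √(c * A ^ ((d : ℝ) - 2 * s)) ≤ r / 2 := by
          rw [show (d : ℝ) - 2 * s = γ * 2 by rw [hγ]; ring, Real.rpow_mul hA0.le, hAγ,
            Real.rpow_two, Real.sqrt_mul hc0.le, Real.sqrt_sq (by positivity), hκ]
          have := Real.sqrt_pos.2 hc0
          refine le_of_eq ?_
          field_simp
        refine (mul_le_mul_left (volume_lt_norm_le hs hu h hE hA0 hr0 hAr) _).trans_eq ?_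
        have e1 : ∀ ξ, S.indicator
            (fun q => ENNReal.ofReal (4 * q.1 ^ (P - 3)) * ‖w q.2‖ₑ ^ 2) (r, ξ) =
            ENNReal.ofReal (4 * r ^ (P - 3)) *
              (Metric.closedBall (0 : 𝔼) A)ᶜ.indicator (fun ξ => ‖w ξ‖ₑ ^ 2) ξ := by
          intro ξ
          have hiff : (r, ξ) ∈ S ↔ ξ ∈ (Metric.closedBall (0 : 𝔼) A)ᶜ := by
            have : ξ ∈ (Metric.closedBall (0 : 𝔼) A)ᶜ ↔ A < ‖ξ‖ := by simp
            rw [this, ← Real.rpow_lt_rpow_iff hA0.le (norm_nonneg ξ) hγ0, hAγ, div_lt_iff₀' hκ0]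
            rfl
          by_cases hm : (r, ξ) ∈ S
          · rw [Set.indicator_of_mem hm, Set.indicator_of_mem (hiff.1 hm)]
          · rw [Set.indicator_of_notMem hm, Set.indicator_of_notMem (fun h => hm (hiff.2 h)),
              mul_zero]
        simp_rw [e1]
        rw [lintegral_const_mul' _ _ ENNReal.ofReal_ne_top,
          lintegral_indicator measurableSet_closedBall.compl, mul_right_comm,
          ← ENNReal.ofReal_mul (by positivity)]
        congr 2
        rw [show P - 1 = (P - 3) + 2 by ring, Real.rpow_add hr0, Real.rpow_two]
        field_simp
    _ = ∫⁻ ξ, ∫⁻ r in Set.Ioi (0 : ℝ), S.indicator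
          (fun q => ENNReal.ofReal (4 * q.1 ^ (P - 3)) * ‖w q.2‖ₑ ^ 2) (r, ξ) := by
        refine lintegral_lintegral_swap ?_
        refine AEMeasurable.indicator ?_ hSm
        exact (by fun_prop : AEMeasurable (fun q : ℝ × 𝔼 => ENNReal.ofReal (4 * q.1 ^ (P - 3)))
          _).mul hwm.comp_snd
    _ = ∫⁻ ξ, ENNReal.ofReal K * ENNReal.ofReal (symbol s ξ * ‖w ξ‖ ^ 2) := by
        refine lintegral_congr fun ξ => ?_
        have e1 : ∀ r : ℝ, S.indicator
            (fun q => ENNReal.ofReal (4 * q.1 ^ (P - 3)) * ‖w q.2‖ₑ ^ 2) (r, ξ) =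
            (Set.Iio (κ * ‖ξ‖ ^ γ)).indicator
              (fun r => ENNReal.ofReal (4 * r ^ (P - 3))) r * ‖w ξ‖ₑ ^ 2 := by
          intro r
          by_cases hm : r < κ * ‖ξ‖ ^ γ
          · rw [Set.indicator_of_mem (show (r, ξ) ∈ S from hm),
              Set.indicator_of_mem (show r ∈ Set.Iio _ from hm)]
          · rw [Set.indicator_of_notMem (show (r, ξ) ∉ S from hm),
              Set.indicator_of_notMem (show r ∉ Set.Iio _ from hm), zero_mul]
        simp_rw [e1]
        have hB : 0 ≤ κ * ‖ξ‖ ^ γ := by positivity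
        have hlt : -1 < P - 3 := by linarith
        rw [lintegral_mul_const' _ _ (by finiteness), lintegral_indicator measurableSet_Iio,
          Measure.restrict_restrict measurableSet_Iio, Set.inter_comm, Set.Ioi_inter_Iio,
          restrict_Ioo_eq_restrict_Ioc, ← ofReal_integral_eq_lintegral_ofReal,
          ← intervalIntegral.integral_of_le hB, intervalIntegral.integral_const_mul,
          integral_rpow (Or.inl hlt), ← ofReal_norm, ← ENNReal.ofReal_pow (norm_nonneg _),
          ← ENNReal.ofReal_mul, ← ENNReal.ofReal_mul]
        · congr 1
          rw [show P - 3 + 1 = P - 2 by ring, Real.zero_rpow (by linarith),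
            Real.mul_rpow hκ0.le (by positivity), ← Real.rpow_mul (norm_nonneg _), hPγ, hK, symbol,
            Real.mul_rpow (by positivity) (norm_nonneg _), Real.rpow_neg (by positivity)]
          field_simp
          ring
        · have : 0 < P - 2 := by linarith
          positivity
        · rw [show P - 3 + 1 = P - 2 by ring, Real.zero_rpow (by linarith)]
          have : 0 < P - 2 := by linarith
          rw [sub_zero]
          positivity
        · exact ((intervalIntegrable_iff_integrableOn_Ioc_of_le hB).1
            (intervalIntegral.intervalIntegrable_rpow' hlt)).const_mul _
        · refine (ae_restrict_iff' measurableSet_Ioc).2 (ae_of_all _ fun r hr => ?_)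
          have := hr.1
          positivity
    _ ≤ ENNReal.ofReal K * 1 := by
        rw [lintegral_const_mul' _ _ ENNReal.ofReal_ne_top,
          ← ofReal_integral_eq_lintegral_ofReal h.energy
            (ae_of_all _ fun ξ => mul_nonneg (symbol_nonneg s ξ) (sq_nonneg _))]
        gcongr
        exact ENNReal.ofReal_le_one.2 hE

namespace HomSobolev
variable {s : ℝ} [hs : Fact (0 < s ∧ s < (d : ℝ) / 2)]

instance : Fact (1 ≤ sobolevExponent d s) := ⟨sobolevExponent_ge_one hs.out⟩

/-- The Sobolev inequality `‖u‖_{2d/(d-2s)} ≤ C ‖u‖_{H̊^s}`. -/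
lemma exists_norm_toLp_le : ∃ C : ℝ, ∀ u : HomSobolev d s, ‖u.toLp‖ ≤ C * ‖u‖ := by
  obtain ⟨C, hC, hb⟩ := exists_lintegral_rpow_le hs.out
  have hds : 0 < (d : ℝ) - 2 * s := by linarith [hs.out.2]
  have hd : (0 : ℝ) < d := by exact_mod_cast pos_of_lt_half hs.out
  set P : ℝ := 2 * (d : ℝ) / (d - 2 * s) with hP
  have hP0 : 0 < P := by positivity
  have hPr : (sobolevExponent d s).toReal = P := ENNReal.toReal_ofReal hP0.le
  have h1 : ∀ u : HomSobolev d s, ‖u‖ ≤ 1 → ‖u.toLp‖ ≤ (C ^ (1 / P)).toReal := by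
    intro u hu
    have hE : ∫ ξ, symbol s ξ * ‖u.fourier ξ‖ ^ 2 ≤ 1 := by
      rw [← innerProd_self, ← inner_eq, real_inner_self_eq_norm_sq]
      exact pow_le_one₀ (norm_nonneg _) hu
    have := hb u u.fourier ((Lp.memLp u.toLp).locallyIntegrable (sobolevExponent_ge_one hs.out))
      u.isSobolevFourier hE
    rw [Lp.norm_def, eLpNorm_eq_lintegral_rpow_enorm_toReal, hPr]
    · refine ENNReal.toReal_mono (ENNReal.rpow_ne_top_of_nonneg (by positivity) hC)
        (ENNReal.rpow_le_rpow ?_ (by positivity))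
      refine le_of_eq_of_le (lintegral_congr fun x => ?_) this
      rw [← ofReal_norm, ENNReal.ofReal_rpow_of_nonneg (norm_nonneg _) hP0.le]
    · exact (ENNReal.ofReal_pos.2 hP0).ne'
    · exact ENNReal.ofReal_ne_top
  refine ⟨(C ^ (1 / P)).toReal, fun u => ?_⟩
  rcases eq_or_ne u 0 with rfl | hu
  · have : (0 : HomSobolev d s).toLp = 0 := rfl
    simp [this]
  · have hn : 0 < ‖u‖ := norm_pos_iff.2 hu
    have := h1 (‖u‖⁻¹ • u) (by rw [norm_smul, norm_inv, norm_norm, inv_mul_cancel₀ hn.ne'])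
    rw [toLp_smul, norm_smul, norm_inv, norm_norm, inv_mul_le_iff₀ hn, mul_comm] at this
    exact this
end HomSobolev

/-! ### Completeness of the homogeneous Sobolev space -/

namespace HomSobolev
variable {s : ℝ} [hs : Fact (0 < s ∧ s < (d : ℝ) / 2)]

/-- The function `(2π|ξ|)^s û(ξ)`, whose `L²` norm is the norm of `u` in `H̊^s`. -/
def weightedFourier (u : HomSobolev d s) (ξ : 𝔼) : ℂ := (√(symbol s ξ) : ℂ) * u.fourier ξ

lemma norm_weightedFourier_sq (u : HomSobolev d s) (ξ : 𝔼) :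
    ‖u.weightedFourier ξ‖ ^ 2 = symbol s ξ * ‖u.fourier ξ‖ ^ 2 := by
  rw [weightedFourier, norm_mul, mul_pow, Complex.norm_real,
    Real.norm_of_nonneg (Real.sqrt_nonneg _), Real.sq_sqrt (symbol_nonneg s ξ)]

lemma memLp_weightedFourier (u : HomSobolev d s) : MemLp u.weightedFourier 2 volume := by
  have hm : AEStronglyMeasurable u.weightedFourier volume :=
    (Complex.measurable_ofReal.comp (measurable_symbol s).sqrt).aestronglyMeasurable.mul
      u.isSobolevFourier.locallyIntegrable.aestronglyMeasurable
  rw [memLp_two_iff_integrable_sq_norm hm]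
  simp_rw [norm_weightedFourier_sq]
  exact u.isSobolevFourier.energy

/-- The isometry `u ↦ √symbol · û` of `H̊^s` into `L²`. -/
def toL2 : HomSobolev d s →ₗᵢ[ℝ] Lp ℂ 2 (volume : Measure 𝔼) where
  toFun u := u.memLp_weightedFourier.toLp _
  map_add' u v := by
    rw [← MemLp.toLp_add, MemLp.toLp_eq_toLp_iff]
    filter_upwards [fourier_add u v] with ξ hξ
    simp only [weightedFourier, hξ, Pi.add_apply]
    ring
  map_smul' c u := by
    rw [RingHom.id_apply, ← MemLp.toLp_const_smul, MemLp.toLp_eq_toLp_iff]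
    filter_upwards [fourier_smul c u] with ξ hξ
    simp only [weightedFourier, hξ, Pi.smul_apply, Complex.real_smul]
    ring
  norm_map' u := by
    change ‖u.memLp_weightedFourier.toLp _‖ = ‖u‖
    rw [Lp.norm_toLp, norm_eq, eLpNorm_eq_lintegral_rpow_enorm_toReal two_ne_zero
      ENNReal.ofNat_ne_top]
    have e : ∫⁻ ξ, ‖u.weightedFourier ξ‖ₑ ^ (2 : ℝ≥0∞).toReal =
        ENNReal.ofReal (∫ ξ, symbol s ξ * ‖u.fourier ξ‖ ^ 2) := by
      rw [ofReal_integral_eq_lintegral_ofReal u.isSobolevFourier.energy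
        (ae_of_all _ fun ξ => mul_nonneg (symbol_nonneg s ξ) (sq_nonneg _))]
      refine lintegral_congr fun ξ => ?_
      rw [← norm_weightedFourier_sq, ENNReal.toReal_ofNat, ENNReal.rpow_ofNat,
        ENNReal.ofReal_pow (norm_nonneg _), ofReal_norm]
    have h0 : 0 ≤ ∫ ξ, symbol s ξ * ‖u.fourier ξ‖ ^ 2 :=
      integral_nonneg fun ξ => mul_nonneg (symbol_nonneg s ξ) (sq_nonneg _)
    rw [e, ENNReal.ofReal_rpow_of_nonneg h0 (by norm_num), ENNReal.toReal_ofReal (by positivity),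
      Real.sqrt_eq_rpow]
    norm_num

lemma coeFn_toL2 (u : HomSobolev d s) : toL2 u =ᵐ[volume] u.weightedFourier :=
  u.memLp_weightedFourier.coeFn_toLp

/-- `u ↦ u` as a bounded linear map into `L^{2d/(d-2s)}`. -/
def toLpCLM : HomSobolev d s →L[ℝ] Lp ℝ (sobolevExponent d s) (volume : Measure 𝔼) :=
  LinearMap.mkContinuousOfExistsBound ⟨⟨toLp, toLp_add⟩, toLp_smul⟩ exists_norm_toLp_le

lemma toLpCLM_apply (u : HomSobolev d s) : toLpCLM u = u.toLp := rfl
end HomSobolev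

lemma memLp_sqrt_symbol_inv_closedBall {s : ℝ} (hs : 0 < s ∧ s < (d : ℝ) / 2) (A : ℝ) :
    MemLp (fun ξ : 𝔼 => (√(symbol s ξ))⁻¹) 2 (volume.restrict (Metric.closedBall 0 A)) := by
  have hm : AEStronglyMeasurable (fun ξ : 𝔼 => (√(symbol s ξ))⁻¹)
      (volume.restrict (Metric.closedBall 0 A)) :=
    (measurable_symbol s).sqrt.inv.aestronglyMeasurable
  rw [memLp_two_iff_integrable_sq hm]
  simp_rw [inv_pow, Real.sq_sqrt (symbol_nonneg s _)]
  exact (integral_symbol_inv_closedBall hs (abs_nonneg A)).1.mono_set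
    (Metric.closedBall_subset_closedBall (le_abs_self A))

/-- Bounded square-integrable functions have finite dual energy: boundedness is used near the origin
and square integrability away from it. -/
lemma integrable_symbol_inv_mul_sq {s : ℝ} (hs : 0 < s ∧ s < (d : ℝ) / 2) {k : 𝔼 → ℂ} {C : ℝ}
    (hk : MemLp k 2 volume) (hC : ∀ ξ, ‖k ξ‖ ≤ C) :
    Integrable (fun ξ => (symbol s ξ)⁻¹ * ‖k ξ‖ ^ 2) volume := by
  have hm : AEStronglyMeasurable (fun ξ => (symbol s ξ)⁻¹ * ‖k ξ‖ ^ 2) volume :=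
    (measurable_symbol s).inv.aestronglyMeasurable.mul (hk.aestronglyMeasurable.norm.pow 2)
  have h0 : ∀ ξ : 𝔼, 0 ≤ (symbol s ξ)⁻¹ := fun ξ => inv_nonneg.2 (symbol_nonneg s ξ)
  rw [← integrableOn_univ, ← Set.union_compl_self (Metric.closedBall 0 1)]
  refine IntegrableOn.union ?_ ?_
  · refine ((integral_symbol_inv_closedBall hs zero_le_one).1.mul_const (C ^ 2)).mono' hm.restrict
      (ae_of_all _ fun ξ => ?_)
    rw [Real.norm_of_nonneg (mul_nonneg (h0 ξ) (sq_nonneg _))]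
    have := h0 ξ
    gcongr
    exact hC ξ
  · refine ((memLp_two_iff_integrable_sq_norm hk.aestronglyMeasurable).1 hk).integrableOn.mono'
      hm.restrict ((ae_restrict_iff' measurableSet_closedBall.compl).2 (ae_of_all _ fun ξ hξ => ?_))
    rw [Real.norm_of_nonneg (mul_nonneg (h0 ξ) (sq_nonneg _))]
    have h1 : 1 ≤ ‖ξ‖ := by
      by_contra! h'
      exact hξ (by simpa using h'.le)
    have h2 : 1 ≤ symbol s ξ := by
      unfold symbol
      refine Real.one_le_rpow ?_ (by linarith [hs.1])
      nlinarith [Real.pi_gt_three]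
    exact mul_le_of_le_one_left (sq_nonneg _) (inv_le_one_of_one_le₀ h2)

namespace HomSobolev
variable {s : ℝ} [hs : Fact (0 < s ∧ s < (d : ℝ) / 2)]

lemma memLp_sqrt_symbol_inv_mul_schwartz (φ : 𝓢(𝔼, ℂ)) :
    MemLp (fun ξ => ((√(symbol s ξ))⁻¹ : ℂ) * φ ξ) 2 volume := by
  have hm : AEStronglyMeasurable (fun ξ => ((√(symbol s ξ))⁻¹ : ℂ) * φ ξ) volume :=
    (Complex.measurable_ofReal.comp (measurable_symbol s).sqrt).inv.aestronglyMeasurable.mul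
      φ.continuous.aestronglyMeasurable
  rw [memLp_two_iff_integrable_sq_norm hm]
  refine (integrable_symbol_inv_mul_sq hs.out (φ.memLp 2 volume)
    (φ.norm_le_seminorm ℝ)).congr (ae_of_all _ fun ξ => ?_)
  simp only [norm_mul, norm_inv, Complex.norm_real, mul_pow, inv_pow, Real.norm_eq_abs, sq_abs]
  rw [Real.sq_sqrt (symbol_nonneg s ξ)]

/-- `H̊^s` is a Hilbert space. For a Cauchy sequence `u n`, the limit `h` of `(2π|ξ|)^s û_n` in `L²`
and the limit `v` of `u n` in `L^{2d/(d-2s)}` satisfy `v̂ = (2π|ξ|)^{-s} h`. -/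
instance : CompleteSpace (HomSobolev d s) := by
  refine Metric.complete_of_cauchySeq_tendsto fun u hu => ?_
  have hd := pos_of_lt_half hs.out
  obtain ⟨h, hh⟩ := cauchySeq_tendsto_of_complete
    (toL2.isometry.uniformContinuous.comp_cauchySeq hu)
  obtain ⟨v, hv⟩ := cauchySeq_tendsto_of_complete (toLpCLM.uniformContinuous.comp_cauchySeq hu)
  set w : 𝔼 → ℂ := fun ξ => ((√(symbol s ξ))⁻¹ : ℂ) * h ξ with hw
  have hsq : ∀ᵐ ξ : 𝔼, (√(symbol s ξ) : ℂ) ≠ 0 := by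
    filter_upwards [ae_ne_zero_of_pos hd] with ξ hξ
    exact_mod_cast (Real.sqrt_pos.2 (symbol_pos hξ)).ne'
  have hS : IsSobolevFourier s v w := by
    refine ⟨?_, ?_, fun φ => ?_⟩
    · rw [locallyIntegrable_iff]
      intro K hK
      obtain ⟨A, hA⟩ := hK.isBounded.subset_closedBall 0
      refine IntegrableOn.mono_set ?_ hA
      have h1 := (memLp_sqrt_symbol_inv_closedBall hs.out A).ofReal (K := ℂ)
      have := h1.integrable_mul ((Lp.memLp h).restrict (Metric.closedBall 0 A))
      refine this.congr (ae_of_all _ fun ξ => ?_)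
      simp [hw]
    · have := (memLp_two_iff_integrable_sq_norm (Lp.aestronglyMeasurable h)).1 (Lp.memLp h)
      refine this.congr ?_
      filter_upwards [hsq] with ξ hξ
      have hn : ‖(√(symbol s ξ) : ℂ)‖ ^ 2 = symbol s ξ := by
        rw [Complex.norm_real, Real.norm_of_nonneg (Real.sqrt_nonneg _),
          Real.sq_sqrt (symbol_nonneg s ξ)]
      have hn0 : symbol s ξ ≠ 0 := by
        rw [← hn]
        exact pow_ne_zero 2 (norm_ne_zero_iff.2 hξ)
      rw [hw, norm_mul, mul_pow, norm_inv, inv_pow, hn, mul_inv_cancel_left₀ hn0]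
    · -- both sides of the pairing are continuous along the sequence
      set k := (memLp_sqrt_symbol_inv_mul_schwartz (s := s) φ).toLp _ with hk
      have hp : (sobolevExponent d s).HolderConjugate
          (ENNReal.conjExponent (sobolevExponent d s)) :=
        .conjExponent (sobolevExponent_ge_one hs.out)
      have hq : Fact (1 ≤ ENNReal.conjExponent (sobolevExponent d s)) := ⟨hp.symm.one_le⟩
      set B1 := (ContinuousLinearMap.mul ℝ ℂ).lpPairing (volume : Measure 𝔼) 2 2 with hB1
      set B2 := (ContinuousLinearMap.lsmul ℝ ℝ : ℝ →L[ℝ] ℂ →L[ℝ] ℂ).lpPairing (volume : Measure 𝔼)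
        (sobolevExponent d s) (ENNReal.conjExponent (sobolevExponent d s)) with hB2
      set Φ := (𝓕 φ : 𝓢(𝔼, ℂ)).toLp (ENNReal.conjExponent (sobolevExponent d s)) volume with hΦ
      have e1 : ∀ f : Lp ℂ 2 (volume : Measure 𝔼),
          B1 f k = ∫ ξ, (((√(symbol s ξ))⁻¹ : ℂ) * f ξ) * φ ξ := by
        intro f
        rw [hB1, ContinuousLinearMap.lpPairing_eq_integral]
        refine integral_congr_ae ?_
        filter_upwards [(memLp_sqrt_symbol_inv_mul_schwartz (s := s) φ).coeFn_toLp] with ξ hξ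
        rw [ContinuousLinearMap.mul_apply', hk, hξ]
        ring
      have e2 : ∀ f : Lp ℝ (sobolevExponent d s) (volume : Measure 𝔼),
          B2 f Φ = ∫ x, (f x : ℂ) * (𝓕 φ) x := by
        intro f
        rw [hB2, ContinuousLinearMap.lpPairing_eq_integral]
        refine integral_congr_ae ?_
        filter_upwards [(𝓕 φ : 𝓢(𝔼, ℂ)).coeFn_toLp
          (ENNReal.conjExponent (sobolevExponent d s)) volume] with ξ hξ
        rw [hΦ, hξ]
        simp
      have e3 : ∀ n, B1 (toL2 (u n)) k = B2 (toLpCLM (u n)) Φ := by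
        intro n
        rw [e1, e2, toLpCLM_apply, ← (u n).isSobolevFourier.pairing φ]
        refine integral_congr_ae ?_
        filter_upwards [coeFn_toL2 (u n), hsq] with ξ hξ hξ0
        rw [hξ, weightedFourier, inv_mul_cancel_left₀ hξ0]
      have t1 : Filter.Tendsto (fun n => B1 (toL2 (u n)) k) Filter.atTop (nhds (B1 h k)) :=
        ((B1.flip k).continuous.tendsto h).comp hh
      have t2 : Filter.Tendsto (fun n => B2 (toLpCLM (u n)) Φ) Filter.atTop (nhds (B2 v Φ)) :=
        ((B2.flip Φ).continuous.tendsto v).comp hv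
      simp_rw [e3] at t1
      have := tendsto_nhds_unique t1 t2
      rw [e1, e2] at this
      exact this
  set U : HomSobolev d s := ⟨v, w, hS⟩ with hU
  have hJ : toL2 U = h := by
    refine Lp.ext ?_
    filter_upwards [coeFn_toL2 U, U.isSobolevFourier.ae_unique hS, hsq] with ξ h1 h2 h3
    rw [h1, weightedFourier, h2, hw]
    exact mul_inv_cancel_left₀ h3 _
  refine ⟨U, ?_⟩
  rw [← hJ] at hh
  exact toL2.isometry.isEmbedding.tendsto_nhds_iff.2 hh

end HomSobolev

/-! ### Nonnegative functions with finite dual energy -/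

lemma conj_fourier_ofReal (f : 𝔼 → ℝ) (ξ : 𝔼) :
    conj ((𝓕 (fun x => (f x : ℂ))) ξ) = (𝓕⁻ (fun x => (f x : ℂ))) ξ := by
  rw [Real.fourier_eq', Real.fourierInv_eq', ← integral_conj]
  congr 1
  ext x
  simp only [smul_eq_mul, map_mul, Complex.conj_ofReal, ← Complex.exp_conj, Complex.conj_I]
  congr 2
  push_cast
  ring

lemma conj_fourierInv_ofReal (f : 𝔼 → ℝ) (ξ : 𝔼) :
    conj ((𝓕⁻ (fun x => (f x : ℂ))) ξ) = (𝓕 (fun x => (f x : ℂ))) ξ := by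
  rw [← conj_fourier_ofReal, Complex.conj_conj]

lemma locallyIntegrable_comp_neg {w : 𝔼 → ℂ} (h : LocallyIntegrable w volume) :
    LocallyIntegrable (fun ξ => w (-ξ)) volume := by
  rw [locallyIntegrable_iff] at h ⊢
  intro K hK
  have := (Measure.measurePreserving_neg (volume : Measure 𝔼)).integrableOn_comp_preimage
    (MeasurableEquiv.neg 𝔼).measurableEmbedding (f := w) (s := Neg.neg '' K)
  have h1 := this.2 (h _ (hK.image continuous_neg))
  rwa [Set.preimage_image_eq _ neg_injective] at h1

/-- The Fourier transform of a real function is Hermitian. -/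
lemma IsSobolevFourier.conj_neg {s : ℝ} {u : 𝔼 → ℝ} {w : 𝔼 → ℂ} (h : IsSobolevFourier s u w) :
    (fun ξ => conj (w (-ξ))) =ᵐ[volume] w := by
  refine ae_eq_of_integral_contDiff_smul_eq ?_ h.locallyIntegrable fun g hg hc => ?_
  · intro x
    obtain ⟨K, hK, hi⟩ := locallyIntegrable_comp_neg h.locallyIntegrable x
    exact ⟨K, hK,
      (Complex.conjLIE.toContinuousLinearEquiv.toContinuousLinearMap).integrable_comp hi⟩
  have hcc : HasCompactSupport (fun x => (g x : ℂ)) :=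
    hc.comp_left (g := fun t : ℝ => (t : ℂ)) rfl
  have hgc : ContDiff ℝ ∞ (fun x => (g x : ℂ)) := Complex.ofRealCLM.contDiff.comp hg
  have hcc' : HasCompactSupport (fun x => (g (-x) : ℂ)) :=
    hcc.comp_homeomorph (Homeomorph.neg 𝔼)
  have hgc' : ContDiff ℝ ∞ (fun x => (g (-x) : ℂ)) := hgc.comp contDiff_neg
  have e1 : ∫ ξ, w ξ * (g ξ : ℂ) = ∫ x, (u x : ℂ) * (𝓕 (fun x => (g x : ℂ))) x :=
    h.pairing (hcc.toSchwartzMap hgc)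
  have e2 : ∫ ξ, w ξ * (g (-ξ) : ℂ) = ∫ x, (u x : ℂ) * (𝓕 (fun x => (g (-x) : ℂ))) x :=
    h.pairing (hcc'.toSchwartzMap hgc')
  have e3 : ∫ ξ, g ξ • conj (w (-ξ)) = conj (∫ ξ, w ξ * (g (-ξ) : ℂ)) := by
    rw [← integral_conj, ← integral_neg_eq_self]
    simp [mul_comm]
  rw [e3, e2, ← integral_conj]
  simp_rw [Complex.real_smul, mul_comm ((g _ : ℝ) : ℂ)]
  rw [e1]
  congr 1
  ext x
  rw [map_mul, Complex.conj_ofReal, conj_fourier_ofReal (fun x => g (-x)),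
    Real.fourierInv_eq_fourier_comp_neg]
  simp

/-- `F` is the Fourier transform of the locally integrable real function `f`, in the sense that
`∫ f φ = ∫ F (𝓕⁻ φ)` for all real test functions `φ`, and `∫ (2π|ξ|)^{-2s} |F(ξ)|² dξ < ∞`. -/
structure IsDualFourier (s : ℝ) (f : 𝔼 → ℝ) (F : 𝔼 → ℂ) : Prop where
  aestronglyMeasurable : AEStronglyMeasurable F volume
  energy : Integrable (fun ξ => (symbol s ξ)⁻¹ * ‖F ξ‖ ^ 2) volume
  locallyIntegrable : LocallyIntegrable f volume
  pairing : ∀ φ : 𝔼 → ℝ, ContDiff ℝ ∞ φ → HasCompactSupport φ →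
    ((∫ x, f x * φ x : ℝ) : ℂ) = ∫ ξ, F ξ * (𝓕⁻ (fun x => (φ x : ℂ))) ξ

/-- The inverse Fourier transform of a test function, as a Schwartz function. -/
lemma exists_schwartz_fourierInv {φ : 𝔼 → ℝ} (hφ : ContDiff ℝ ∞ φ) (hc : HasCompactSupport φ) :
    ∃ k : 𝓢(𝔼, ℂ), (k : 𝔼 → ℂ) = 𝓕⁻ (fun x => (φ x : ℂ)) := by
  have hcc : HasCompactSupport (fun x => (φ x : ℂ)) :=
    hc.comp_left (g := fun t : ℝ => (t : ℂ)) rfl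
  have hgc : ContDiff ℝ ∞ (fun x => (φ x : ℂ)) := Complex.ofRealCLM.contDiff.comp hφ
  exact ⟨𝓕⁻ (hcc.toSchwartzMap hgc), by rw [SchwartzMap.fourierInv_coe]; rfl⟩

lemma exists_symbol_mul_sq_le {s : ℝ} (hs : 0 < s) (k : 𝓢(𝔼, ℂ)) :
    ∃ C : ℝ, ∀ ξ, symbol s ξ * ‖k ξ‖ ^ 2 ≤ C := by
  obtain ⟨n, hn⟩ := exists_nat_ge (2 * s)
  obtain ⟨C0, hC0, h0⟩ := k.decay 0 0
  obtain ⟨C1, hC1, h1⟩ := k.decay n 0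
  simp only [norm_iteratedFDeriv_zero, pow_zero, one_mul] at h0 h1
  refine ⟨(C0 + (2 * Real.pi) ^ n * C1) * C0, fun ξ => ?_⟩
  have hsym : symbol s ξ ≤ 1 + (2 * Real.pi) ^ n * ‖ξ‖ ^ n := by
    rw [← mul_pow]
    unfold symbol
    have hy : 0 ≤ 2 * Real.pi * ‖ξ‖ := by positivity
    rcases le_total (2 * Real.pi * ‖ξ‖) 1 with h | h
    · have := Real.rpow_le_one hy h (by linarith : 0 ≤ 2 * s)
      have := pow_nonneg hy n
      linarith
    · have := Real.rpow_le_rpow_of_exponent_le h hn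
      rw [Real.rpow_natCast] at this
      linarith
  calc symbol s ξ * ‖k ξ‖ ^ 2 ≤ (1 + (2 * Real.pi) ^ n * ‖ξ‖ ^ n) * ‖k ξ‖ ^ 2 := by gcongr
    _ = (‖k ξ‖ + (2 * Real.pi) ^ n * (‖ξ‖ ^ n * ‖k ξ‖)) * ‖k ξ‖ := by ring
    _ ≤ (C0 + (2 * Real.pi) ^ n * C1) * C0 := by
      gcongr
      · exact h0 ξ
      · exact h1 ξ
      · exact h0 ξ

/-- The product of `F` with the inverse Fourier transform `k` of a test function is integrable,
since `(2π|ξ|)^{-s} F` and `(2π|ξ|)^s k` lie in `L²`, and square integrable, since `(2π|ξ|)^s k` is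
bounded. -/
lemma IsDualFourier.mul_schwartz {s : ℝ} (hs : 0 < s ∧ s < (d : ℝ) / 2) {f : 𝔼 → ℝ} {F : 𝔼 → ℂ}
    (h : IsDualFourier s f F) {φ : 𝔼 → ℝ} (hφ : ContDiff ℝ ∞ φ) (hc : HasCompactSupport φ) :
    Integrable (fun ξ => F ξ * (𝓕⁻ (fun x => (φ x : ℂ))) ξ) volume ∧
      MemLp (fun ξ => F ξ * (𝓕⁻ (fun x => (φ x : ℂ))) ξ) 2 volume := by
  have hd := pos_of_lt_half hs
  have : Fact (0 < s ∧ s < (d : ℝ) / 2) := ⟨hs⟩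
  obtain ⟨k, hk⟩ := exists_schwartz_fourierInv hφ hc
  have hen : Integrable (fun ξ => symbol s ξ * ‖k ξ‖ ^ 2) volume := by
    have := (HomSobolev.isSobolevFourier_test (s := s) (hφ.comp contDiff_neg)
      (hc.comp_homeomorph (Homeomorph.neg 𝔼))).energy
    rw [hk, Real.fourierInv_eq_fourier_comp_neg]
    exact this
  rw [← hk]
  have hm : AEStronglyMeasurable (fun ξ => F ξ * k ξ) volume :=
    h.aestronglyMeasurable.mul k.continuous.aestronglyMeasurable
  constructor
  · refine (h.energy.add hen).mono' hm ?_
    filter_upwards [ae_ne_zero_of_pos hd] with ξ hξ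
    have hsy := symbol_pos (s := s) hξ
    have e : (symbol s ξ)⁻¹ * ‖F ξ‖ ^ 2 + symbol s ξ * ‖k ξ‖ ^ 2 - ‖F ξ‖ * ‖k ξ‖ =
        (symbol s ξ)⁻¹ * ((‖F ξ‖ - symbol s ξ * ‖k ξ‖ / 2) ^ 2 +
          3 / 4 * (symbol s ξ * ‖k ξ‖) ^ 2) := by
      field_simp
      ring
    have e0 : 0 ≤ (symbol s ξ)⁻¹ * ((‖F ξ‖ - symbol s ξ * ‖k ξ‖ / 2) ^ 2 +
          3 / 4 * (symbol s ξ * ‖k ξ‖) ^ 2) := by positivity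
    rw [norm_mul]
    simp only [Pi.add_apply]
    linarith
  · rw [memLp_two_iff_integrable_sq_norm hm]
    obtain ⟨C, hC⟩ := exists_symbol_mul_sq_le hs.1 k
    refine (h.energy.const_mul C).mono' (hm.norm.pow 2) ?_
    filter_upwards [ae_ne_zero_of_pos hd] with ξ hξ
    have hsy := symbol_pos (s := s) hξ
    rw [Real.norm_of_nonneg (sq_nonneg _), norm_mul, mul_pow]
    calc ‖F ξ‖ ^ 2 * ‖k ξ‖ ^ 2
        = (symbol s ξ * ‖k ξ‖ ^ 2) * ((symbol s ξ)⁻¹ * ‖F ξ‖ ^ 2) := by field_simp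
      _ ≤ C * ((symbol s ξ)⁻¹ * ‖F ξ‖ ^ 2) := by gcongr; exact hC ξ

lemma fourierInv_comp_sub (f : 𝔼 → ℂ) (z ξ : 𝔼) :
    (𝓕⁻ (fun x => f (x - z))) ξ = Real.fourierChar (inner ℝ ξ z) • (𝓕⁻ f) ξ := by
  rw [Real.fourierInv_eq, Real.fourierInv_eq,
    ← integral_add_right_eq_self (fun x => Real.fourierChar (inner ℝ x ξ) • f (x - z)) z]
  simp only [Circle.smul_def, smul_eq_mul]
  rw [← integral_const_mul]
  congr 1
  ext x
  rw [inner_add_left, AddChar.map_add_eq_mul, Circle.coe_mul, add_sub_cancel_right,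
    real_inner_comm z ξ]
  ring

/-- The pairing of `f` with the translate of `φ` by `z` is the inverse Fourier transform at `z` of
`F · 𝓕⁻ φ`. -/
lemma IsDualFourier.ofReal_integral_translate {s : ℝ} {f : 𝔼 → ℝ} {F : 𝔼 → ℂ}
    (h : IsDualFourier s f F) {φ : 𝔼 → ℝ} (hφ : ContDiff ℝ ∞ φ) (hc : HasCompactSupport φ) (z : 𝔼) :
    ((∫ x, f x * φ (x - z) : ℝ) : ℂ) = (𝓕⁻ (fun ξ => F ξ * (𝓕⁻ (fun x => (φ x : ℂ))) ξ)) z := by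
  rw [h.pairing (fun x => φ (x - z)) (hφ.comp (contDiff_id.sub contDiff_const))
    (hc.comp_homeomorph (Homeomorph.subRight z)), Real.fourierInv_eq]
  congr 1
  ext ξ
  rw [fourierInv_comp_sub (fun x => (φ x : ℂ)), mul_smul_comm]

/-- Plancherel's theorem for the pairings of `f` with the translates of `φ`. -/
lemma IsDualFourier.lintegral_sq_translate {s : ℝ} (hs : 0 < s ∧ s < (d : ℝ) / 2) {f : 𝔼 → ℝ}
    {F : 𝔼 → ℂ} (h : IsDualFourier s f F) (hf : ∀ x, 0 ≤ f x)
    {φ : 𝔼 → ℝ} (hφ : ContDiff ℝ ∞ φ) (hc : HasCompactSupport φ) (hφ0 : ∀ x, 0 ≤ φ x) :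
    ∫⁻ z, (∫⁻ x, ENNReal.ofReal (f x) * ENNReal.ofReal (φ (x - z))) ^ 2 =
      ∫⁻ ξ, ‖F ξ‖ₑ ^ 2 * ‖(𝓕⁻ (fun x => (φ x : ℂ))) ξ‖ₑ ^ 2 := by
  obtain ⟨h1, h2⟩ := h.mul_schwartz hs hφ hc
  have := lintegral_enorm_fourierInv_sq h1 h2
  simp_rw [enorm_mul, mul_pow] at this
  rw [← this]
  refine lintegral_congr fun z => ?_
  rw [← h.ofReal_integral_translate hφ hc z]
  have hi : Integrable (fun x => f x * φ (x - z)) volume := by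
    have := h.locallyIntegrable.integrable_smul_left_of_hasCompactSupport
      (g := fun x => φ (x - z)) (hφ.continuous.comp (continuous_sub_right z))
      (hc.comp_homeomorph (Homeomorph.subRight z))
    simpa [mul_comm] using! this
  have h0 : ∀ x, 0 ≤ f x * φ (x - z) := fun x => mul_nonneg (hf x) (hφ0 _)
  have e : ∫⁻ x, ENNReal.ofReal (f x) * ENNReal.ofReal (φ (x - z)) =
      ENNReal.ofReal (∫ x, f x * φ (x - z)) := by
    rw [ofReal_integral_eq_lintegral_ofReal hi (ae_of_all _ h0)]
    exact lintegral_congr fun x => (ENNReal.ofReal_mul (hf x)).symm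
  rw [e, ← ofReal_norm (_ : ℂ), Complex.norm_real, Real.norm_of_nonneg (integral_nonneg h0)]

/-! ### Superposition of dilated bumps -/

lemma lintegral_comp_smul {E : Type*} [NormedAddCommGroup E] [NormedSpace ℝ E]
    [FiniteDimensional ℝ E] [MeasurableSpace E] [BorelSpace E] (μ : Measure E) [μ.IsAddHaarMeasure]
    (f : E → ℝ≥0∞) {ρ : ℝ} (hρ : 0 < ρ) :
    ∫⁻ x, f (ρ • x) ∂μ = ENNReal.ofReal ((ρ ^ Module.finrank ℝ E)⁻¹) * ∫⁻ x, f x ∂μ := by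
  have h := (Homeomorph.smulOfNeZero ρ hρ.ne' (α := E)).measurableEmbedding.lintegral_map
    (μ := μ) f
  change ∫⁻ a, f a ∂(μ.map (ρ • ·)) = ∫⁻ x, f (ρ • x) ∂μ at h
  rw [← h, Measure.map_addHaar_smul μ hρ.ne', lintegral_smul_measure, smul_eq_mul,
    abs_of_pos (by positivity)]

lemma lintegral_Ioi_comp_mul (f : ℝ → ℝ≥0∞) {ρ : ℝ} (hρ : 0 < ρ) :
    ∫⁻ r in Set.Ioi (0 : ℝ), f r = ENNReal.ofReal ρ * ∫⁻ r in Set.Ioi (0 : ℝ), f (ρ * r) := by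
  have h := lintegral_comp_smul volume ((Set.Ioi (0 : ℝ)).indicator f) hρ
  have e : ∀ r : ℝ, (Set.Ioi (0 : ℝ)).indicator f (ρ • r) =
      (Set.Ioi (0 : ℝ)).indicator (fun r => f (ρ * r)) r := by
    intro r
    simp only [Set.indicator, Set.mem_Ioi, smul_eq_mul, mul_pos_iff_of_pos_left hρ]
  simp_rw [e] at h
  rw [lintegral_indicator measurableSet_Ioi, lintegral_indicator measurableSet_Ioi] at h
  rw [h, ← mul_assoc, ← ENNReal.ofReal_mul hρ.le]
  simp [hρ.ne']

/-- A radial function that is positively homogeneous of degree `a` is a multiple of `‖v‖ ^ a`. -/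
lemma eq_rpow_norm_mul {P : 𝔼 → ℝ≥0∞} {a : ℝ}
    (hiso : ∀ (Q : 𝔼 ≃ₗᵢ[ℝ] 𝔼) v, P (Q v) = P v)
    (hhom : ∀ (ρ : ℝ) v, 0 < ρ → P (ρ • v) = ENNReal.ofReal (ρ ^ a) * P v)
    {e v : 𝔼} (he : ‖e‖ = 1) (hv : v ≠ 0) : P v = ENNReal.ofReal (‖v‖ ^ a) * P e := by
  have hn := norm_pos_iff.2 hv
  have h1 : ‖e‖ = ‖‖v‖⁻¹ • v‖ := by
    rw [he, norm_smul, norm_inv, norm_norm, inv_mul_cancel₀ hn.ne']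
  have h2 := hiso (Submodule.reflection (Submodule.span ℝ {e - ‖v‖⁻¹ • v})ᗮ) e
  rw [Submodule.reflection_sub h1] at h2
  rw [← h2, ← hhom _ _ hn, smul_smul, mul_inv_cancel₀ hn.ne', one_smul]

/-- A smooth nonnegative radial function supported in the unit ball, positive at the origin. -/
def radialBump (x : 𝔼) : ℝ := Real.smoothTransition (1 - ‖x‖ ^ 2)

lemma contDiff_radialBump : ContDiff ℝ ∞ (radialBump : 𝔼 → ℝ) :=
  Real.smoothTransition.contDiff.comp (contDiff_const.sub (contDiff_norm_sq ℝ))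

lemma radialBump_nonneg (x : 𝔼) : 0 ≤ radialBump x := Real.smoothTransition.nonneg _

lemma hasCompactSupport_radialBump : HasCompactSupport (radialBump : 𝔼 → ℝ) := by
  refine HasCompactSupport.of_support_subset_isCompact (isCompact_closedBall 0 1) fun x hx => ?_
  by_contra h
  refine hx (Real.smoothTransition.zero_of_nonpos ?_)
  have : 1 < ‖x‖ := by simpa using h
  nlinarith

lemma radialBump_isometry (Q : 𝔼 ≃ₗᵢ[ℝ] 𝔼) (x : 𝔼) : radialBump (Q x) = radialBump x := by
  simp [radialBump]

/-- The bump dilated to scale `r`. -/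
def dilatedBump (r : ℝ) (x : 𝔼) : ℝ := radialBump (r⁻¹ • x)

lemma dilatedBump_nonneg (r : ℝ) (x : 𝔼) : 0 ≤ dilatedBump r x := radialBump_nonneg _

lemma contDiff_dilatedBump (r : ℝ) : ContDiff ℝ ∞ (dilatedBump r : 𝔼 → ℝ) :=
  contDiff_radialBump.comp (contDiff_const_smul r⁻¹)

lemma hasCompactSupport_dilatedBump {r : ℝ} (hr : 0 < r) :
    HasCompactSupport (dilatedBump r : 𝔼 → ℝ) :=
  hasCompactSupport_radialBump.comp_homeomorph (Homeomorph.smulOfNeZero r⁻¹ (inv_pos.2 hr).ne')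

lemma measurable_dilatedBump : Measurable (fun p : ℝ × 𝔼 => dilatedBump p.1 p.2) :=
  contDiff_radialBump.continuous.measurable.comp (measurable_fst.inv.smul measurable_snd)

lemma dilatedBump_isometry (r : ℝ) (Q : 𝔼 ≃ₗᵢ[ℝ] 𝔼) (x : 𝔼) :
    dilatedBump r (Q x) = dilatedBump r x := by
  rw [dilatedBump, ← map_smul, radialBump_isometry, dilatedBump]

lemma dilatedBump_neg (r : ℝ) (x : 𝔼) : dilatedBump r (-x) = dilatedBump r x := by
  simp [dilatedBump, radialBump]

lemma dilatedBump_mul_smul {ρ : ℝ} (hρ : 0 < ρ) (r : ℝ) (x : 𝔼) :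
    dilatedBump (ρ * r) (ρ • x) = dilatedBump r x := by
  rw [dilatedBump, dilatedBump, smul_smul, mul_inv_rev, mul_assoc, inv_mul_cancel₀ hρ.ne', mul_one]

lemma fourierInv_dilatedBump {r : ℝ} (hr : 0 < r) (ξ : 𝔼) :
    (𝓕⁻ (fun x : 𝔼 => (dilatedBump r x : ℂ))) ξ =
      (r : ℂ) ^ d * (𝓕⁻ (fun x : 𝔼 => (radialBump x : ℂ))) (r • ξ) := by
  rw [Real.fourierInv_eq, Real.fourierInv_eq]
  have h := Measure.integral_comp_smul (volume : Measure 𝔼)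
    (fun x => Real.fourierChar (inner ℝ x (r • ξ)) • (radialBump x : ℂ)) r⁻¹
  rw [finrank_euclideanSpace_fin, inv_pow, inv_inv, abs_of_pos (by positivity)] at h
  rw [← Complex.ofReal_pow, ← Complex.real_smul, ← h]
  congr 1
  ext x
  rw [inner_smul_left, inner_smul_right, dilatedBump]
  congr 2
  simp [hr.ne']

/-- The autocorrelation of the dilated bump. -/
def bumpCorrelation (r : ℝ) (v : 𝔼) : ℝ≥0∞ :=
  ∫⁻ z, ENNReal.ofReal (dilatedBump r (v - z)) * ENNReal.ofReal (dilatedBump r z)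

lemma bumpCorrelation_isometry (r : ℝ) (Q : 𝔼 ≃ₗᵢ[ℝ] 𝔼) (v : 𝔼) :
    bumpCorrelation r (Q v) = bumpCorrelation r v := by
  rw [bumpCorrelation, ← Q.measurePreserving.lintegral_comp_emb Q.toHomeomorph.measurableEmbedding]
  simp_rw [← map_sub, dilatedBump_isometry]
  rfl

lemma bumpCorrelation_mul_smul {ρ : ℝ} (hρ : 0 < ρ) (r : ℝ) (v : 𝔼) :
    bumpCorrelation (ρ * r) (ρ • v) = ENNReal.ofReal (ρ ^ d) * bumpCorrelation r v := by
  have h := lintegral_comp_smul (volume : Measure 𝔼) (fun z =>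
    ENNReal.ofReal (dilatedBump (ρ * r) (ρ • v - z)) *
      ENNReal.ofReal (dilatedBump (ρ * r) z)) hρ
  simp_rw [← smul_sub, dilatedBump_mul_smul hρ] at h
  rw [finrank_euclideanSpace_fin] at h
  rw [bumpCorrelation, bumpCorrelation, h, ← mul_assoc, ← ENNReal.ofReal_mul (by positivity),
    mul_inv_cancel₀ (by positivity), ENNReal.ofReal_one, one_mul]

/-- The superposition of the autocorrelations over all scales, with the power of `r` that makes it
homogeneous of degree `2s - d`. -/
def spatialProfile (s : ℝ) (v : 𝔼) : ℝ≥0∞ :=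
  ∫⁻ r in Set.Ioi (0 : ℝ), ENNReal.ofReal (r ^ (2 * s - 2 * d - 1)) * bumpCorrelation r v

/-- The superposition of the squared Fourier transforms of the dilated bumps, with the same weights
as in `spatialProfile`; it is homogeneous of degree `-2s`. The Fourier transform of the bump at
scale `r` contributes a factor `r ^ (2d)` to the weight. -/
def freqProfile (s : ℝ) (ξ : 𝔼) : ℝ≥0∞ :=
  ∫⁻ r in Set.Ioi (0 : ℝ), ENNReal.ofReal (r ^ (2 * s - 1)) *
    ‖(𝓕⁻ (fun x : 𝔼 => (radialBump x : ℂ))) (r • ξ)‖ₑ ^ 2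

lemma spatialProfile_eq (s : ℝ) {e v : 𝔼} (he : ‖e‖ = 1) (hv : v ≠ 0) :
    spatialProfile s v = ENNReal.ofReal (‖v‖ ^ (2 * s - d)) * spatialProfile s e := by
  refine eq_rpow_norm_mul (fun Q v => ?_) (fun ρ v hρ => ?_) he hv
  · simp_rw [spatialProfile, bumpCorrelation_isometry]
  · rw [spatialProfile, lintegral_Ioi_comp_mul _ hρ, spatialProfile]
    simp_rw [bumpCorrelation_mul_smul hρ]
    rw [← lintegral_const_mul' _ _ ENNReal.ofReal_ne_top,
      ← lintegral_const_mul' _ _ ENNReal.ofReal_ne_top]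
    refine setLIntegral_congr_fun measurableSet_Ioi fun r hr => ?_
    have hr0 : 0 < r := hr
    rw [← mul_assoc, ← mul_assoc, ← mul_assoc, ← ENNReal.ofReal_mul (by positivity),
      ← ENNReal.ofReal_mul (by positivity), ← ENNReal.ofReal_mul (by positivity)]
    congr 2
    rw [Real.mul_rpow hρ.le hr0.le,
      show (2 * s - d : ℝ) = 1 + (2 * s - 2 * d - 1) + d by ring, Real.rpow_add hρ,
      Real.rpow_add hρ, Real.rpow_one, Real.rpow_natCast]
    ring

lemma freqProfile_eq (s : ℝ) {e ξ : 𝔼} (he : ‖e‖ = 1) (hξ : ξ ≠ 0) :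
    freqProfile s ξ = ENNReal.ofReal (‖ξ‖ ^ (-(2 * s))) * freqProfile s e := by
  refine eq_rpow_norm_mul (fun Q v => ?_) (fun ρ v hρ => ?_) he hξ
  · have h : ∀ r : ℝ, (𝓕⁻ (fun x : 𝔼 => (radialBump x : ℂ))) (r • Q v) =
        (𝓕⁻ (fun x : 𝔼 => (radialBump x : ℂ))) (r • v) := by
      intro r
      have hQ : (fun x : 𝔼 => (radialBump x : ℂ)) ∘ Q = fun x => (radialBump x : ℂ) := by
        ext x
        simp [radialBump_isometry]
      rw [← map_smul, ← Real.fourierInv_comp_linearIsometry, hQ]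
    simp_rw [freqProfile, h]
  · rw [freqProfile, lintegral_Ioi_comp_mul _ (inv_pos.2 hρ), freqProfile,
      ← lintegral_const_mul' _ _ ENNReal.ofReal_ne_top,
      ← lintegral_const_mul' _ _ ENNReal.ofReal_ne_top]
    refine setLIntegral_congr_fun measurableSet_Ioi fun r hr => ?_
    have hr0 : 0 < r := hr
    rw [smul_smul, mul_right_comm ρ⁻¹ r ρ, inv_mul_cancel₀ hρ.ne', one_mul, ← mul_assoc,
      ← mul_assoc, ← ENNReal.ofReal_mul (by positivity), ← ENNReal.ofReal_mul (by positivity)]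
    congr 2
    rw [Real.mul_rpow (by positivity) hr0.le, Real.inv_rpow hρ.le, ← Real.rpow_neg hρ.le,
      ← Real.rpow_neg_one ρ, ← mul_assoc, ← Real.rpow_add hρ]
    congr 2
    ring

/-- The integral over the scales converges at `0` because `s > 0` and at `∞` because the Fourier
transform of the bump decays rapidly. -/
lemma freqProfile_ne_top {s : ℝ} (hs : 0 < s) {e : 𝔼} (he : ‖e‖ = 1) : freqProfile s e ≠ ⊤ := by
  obtain ⟨k, hk⟩ := exists_schwartz_fourierInv (contDiff_radialBump (d := d))
    hasCompactSupport_radialBump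
  obtain ⟨n, hn⟩ := exists_nat_ge (s + 1)
  obtain ⟨C0, hC0, h0⟩ := k.decay 0 0
  obtain ⟨C1, hC1, h1⟩ := k.decay n 0
  simp only [norm_iteratedFDeriv_zero, pow_zero, one_mul] at h0 h1
  have hi : IntegrableOn (fun r : ℝ => r ^ (2 * s - 1) * ‖k (r • e)‖ ^ 2) (Set.Ioi 0) volume := by
    have hm : AEStronglyMeasurable (fun r : ℝ => r ^ (2 * s - 1) * ‖k (r • e)‖ ^ 2) volume := by
      refine AEStronglyMeasurable.mul ?_ ?_
      · exact (measurable_id.pow_const _).aestronglyMeasurable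
      · exact ((k.continuous.comp (continuous_id.smul continuous_const)).norm.pow
          2).aestronglyMeasurable
    rw [← Set.Ioc_union_Ioi_eq_Ioi zero_le_one]
    refine IntegrableOn.union ?_ ?_
    · refine Integrable.mono' (g := fun r => r ^ (2 * s - 1) * C0 ^ 2)
        (((intervalIntegrable_iff_integrableOn_Ioc_of_le zero_le_one).1
          (intervalIntegral.intervalIntegrable_rpow' (by linarith))).mul_const _) hm.restrict ?_
      refine (ae_restrict_iff' measurableSet_Ioc).2 (ae_of_all _ fun r hr => ?_)
      have hr0 := hr.1
      rw [Real.norm_of_nonneg (by positivity)]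
      gcongr
      exact h0 _
    · refine Integrable.mono' (g := fun r => r ^ (2 * s - 1 - 2 * n) * C1 ^ 2)
        ((integrableOn_Ioi_rpow_of_lt (by linarith) one_pos).mul_const _) hm.restrict ?_
      refine (ae_restrict_iff' measurableSet_Ioi).2 (ae_of_all _ fun r hr => ?_)
      have hr0 : 0 < r := one_pos.trans hr
      rw [Real.norm_of_nonneg (by positivity)]
      have h2 := h1 (r • e)
      rw [norm_smul, he, mul_one, Real.norm_of_nonneg hr0.le] at h2
      have h3 : (r : ℝ) ^ (2 * (n : ℝ)) = (r ^ n) ^ 2 := by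
        rw [mul_comm, Real.rpow_mul hr0.le, Real.rpow_natCast, Real.rpow_two]
      rw [Real.rpow_sub hr0 (2 * s - 1), h3]
      calc r ^ (2 * s - 1) * ‖k (r • e)‖ ^ 2
          = r ^ (2 * s - 1) / (r ^ n) ^ 2 * (r ^ n * ‖k (r • e)‖) ^ 2 := by field_simp
        _ ≤ r ^ (2 * s - 1) / (r ^ n) ^ 2 * C1 ^ 2 := by gcongr
  refine ne_of_lt (lt_of_le_of_lt (le_of_eq ?_) hi.lintegral_lt_top)
  rw [freqProfile, ← hk]
  refine setLIntegral_congr_fun measurableSet_Ioi fun r hr => ?_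
  have hr0 : 0 < r := hr
  rw [ENNReal.ofReal_mul (by positivity), ENNReal.ofReal_pow (norm_nonneg _), ofReal_norm]

lemma freqProfile_ne_zero (s : ℝ) (e : 𝔼) : freqProfile s e ≠ 0 := by
  obtain ⟨k, hk⟩ := exists_schwartz_fourierInv (contDiff_radialBump (d := d))
    hasCompactSupport_radialBump
  have hk0 : k 0 ≠ 0 := by
    rw [hk, Real.fourierInv_eq]
    simp only [inner_zero_right, AddChar.map_zero_eq_one, one_smul]
    rw [show ∫ v : 𝔼, (radialBump v : ℂ) = ((∫ v : 𝔼, radialBump v : ℝ) : ℂ) from integral_ofReal]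
    refine Complex.ofReal_ne_zero.2 (ne_of_gt ?_)
    refine (contDiff_radialBump.continuous.integral_pos_of_hasCompactSupport_nonneg_nonzero
      hasCompactSupport_radialBump (x := 0) radialBump_nonneg ?_)
    simp [radialBump]
  have hc : Continuous fun r : ℝ => k (r • e) :=
    k.continuous.comp (continuous_id.smul continuous_const)
  -- the transform at the origin is the integral of the bump, so the integrand is positive near `0`
  have hev : ∀ᶠ r : ℝ in nhds 0, k (r • e) ≠ 0 :=
    hc.continuousAt.eventually_ne (by simpa using hk0)
  obtain ⟨δ, hδ, hball⟩ := Metric.eventually_nhds_iff.1 hev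
  refine ne_of_gt ?_
  rw [freqProfile, ← hk, setLIntegral_pos_iff]
  · refine lt_of_lt_of_le ?_ (measure_mono (s := Set.Ioo 0 δ) fun r hr => ⟨?_, hr.1⟩)
    · simpa using hδ
    · have hr0 := hr.1
      have : k (r • e) ≠ 0 := hball (by rw [Real.dist_eq, sub_zero, abs_of_pos hr0]; exact hr.2)
      have h3 : 0 < r ^ (2 * s - 1) := by positivity
      simp [this, h3]
  · exact (measurable_id.pow_const _).ennreal_ofReal.mul (hc.measurable.enorm.pow_const 2)

/-! ### The energy identity up to a constant -/

/-- Expanding the square turns the pairings with all translates into a double integral against the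
autocorrelation. -/
lemma lintegral_sq_dilatedBump {a : 𝔼 → ℝ≥0∞} (ha : Measurable a) (r : ℝ) :
    ∫⁻ z, (∫⁻ x, a x * ENNReal.ofReal (dilatedBump r (x - z))) ^ 2 =
      ∫⁻ x, ∫⁻ y, a x * a y * bumpCorrelation r (x - y) := by
  have hb : Measurable (fun x : 𝔼 => ENNReal.ofReal (dilatedBump r x)) :=
    (contDiff_dilatedBump r).continuous.measurable.ennreal_ofReal
  set b : 𝔼 → ℝ≥0∞ := fun x => ENNReal.ofReal (dilatedBump r x) with hbdef
  have hM : ∀ x y, ∫⁻ z, b (x - z) * b (y - z) = bumpCorrelation r (x - y) := by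
    intro x y
    rw [← lintegral_add_left_eq_self _ y, bumpCorrelation]
    refine lintegral_congr fun z => ?_
    change ENNReal.ofReal (dilatedBump r (x - (y + z))) *
      ENNReal.ofReal (dilatedBump r (y - (y + z))) = _
    rw [sub_add_cancel_left, dilatedBump_neg, sub_sub]
  have hsq : ∀ z, (∫⁻ x, a x * b (x - z)) ^ 2 =
      ∫⁻ x, ∫⁻ y, (a x * b (x - z)) * (a y * b (y - z)) := by
    intro z
    have hm : Measurable fun x => a x * b (x - z) := ha.mul (hb.comp (measurable_sub_const z))
    rw [sq, ← lintegral_mul_const _ hm]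
    exact lintegral_congr fun x => (lintegral_const_mul _ hm).symm
  change ∫⁻ z, (∫⁻ x, a x * b (x - z)) ^ 2 = _
  simp_rw [hsq]
  rw [lintegral_lintegral_swap]
  · refine lintegral_congr fun x => ?_
    rw [lintegral_lintegral_swap]
    · refine lintegral_congr fun y => ?_
      rw [← hM, ← lintegral_const_mul]
      · exact lintegral_congr fun z => by ring
      · exact (hb.comp (measurable_const.sub measurable_id)).mul
          (hb.comp (measurable_const.sub measurable_id))
    · exact Measurable.aemeasurable (by fun_prop)
  · refine Measurable.aemeasurable ?_
    refine Measurable.lintegral_prod_right' (f := fun q : (𝔼 × 𝔼) × 𝔼 =>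
      (a q.1.2 * b (q.1.2 - q.1.1)) * (a q.2 * b (q.2 - q.1.1))) ?_
    fun_prop

lemma measurable_bumpCorrelation :
    Measurable (fun p : ℝ × 𝔼 => bumpCorrelation p.1 p.2) := by
  unfold bumpCorrelation
  refine Measurable.lintegral_prod_right' (f := fun q : (ℝ × 𝔼) × 𝔼 =>
    ENNReal.ofReal (dilatedBump q.1.1 (q.1.2 - q.2)) *
      ENNReal.ofReal (dilatedBump q.1.1 q.2)) ?_
  exact (measurable_dilatedBump.comp (f := fun q : (ℝ × 𝔼) × 𝔼 => (q.1.1, q.1.2 - q.2))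
    (by fun_prop)).ennreal_ofReal.mul
    (measurable_dilatedBump.comp (f := fun q : (ℝ × 𝔼) × 𝔼 => (q.1.1, q.2))
      (by fun_prop)).ennreal_ofReal

/-- Plancherel's theorem at scale `r`, integrated over all scales. -/
lemma IsDualFourier.lintegral_profile {s : ℝ} (hs : 0 < s ∧ s < (d : ℝ) / 2) {f : 𝔼 → ℝ}
    {F : 𝔼 → ℂ} (h : IsDualFourier s f F) (hfm : Measurable f) (hf : ∀ x, 0 ≤ f x) :
    ∫⁻ x, ∫⁻ y, ENNReal.ofReal (f x) * ENNReal.ofReal (f y) * spatialProfile s (x - y) =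
      ∫⁻ ξ, ‖F ξ‖ₑ ^ 2 * freqProfile s ξ := by
  have ha : Measurable (fun x => ENNReal.ofReal (f x)) := hfm.ennreal_ofReal
  set a : 𝔼 → ℝ≥0∞ := fun x => ENNReal.ofReal (f x) with hadef
  set W : ℝ → ℝ≥0∞ := fun r : ℝ => ENNReal.ofReal (r ^ (2 * s - 2 * d - 1)) with hW
  have hM := measurable_bumpCorrelation (d := d)
  have hL : ∫⁻ x, ∫⁻ y, a x * a y * spatialProfile s (x - y) =
      ∫⁻ r in Set.Ioi (0 : ℝ), W r *
        ∫⁻ z, (∫⁻ x, a x * ENNReal.ofReal (dilatedBump r (x - z))) ^ 2 := by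
    have hM3 : Measurable fun q : (𝔼 × ℝ) × 𝔼 =>
        W q.1.2 * (a q.1.1 * a q.2 * bumpCorrelation q.1.2 (q.1.1 - q.2)) := by
      have := hM.comp (f := fun q : (𝔼 × ℝ) × 𝔼 => (q.1.2, q.1.1 - q.2)) (by fun_prop)
      fun_prop
    simp_rw [lintegral_sq_dilatedBump ha]
    have e1 : ∀ r, W r * ∫⁻ x, ∫⁻ y, a x * a y * bumpCorrelation r (x - y) =
        ∫⁻ x, ∫⁻ y, W r * (a x * a y * bumpCorrelation r (x - y)) := by
      intro r
      rw [← lintegral_const_mul' _ _ ENNReal.ofReal_ne_top]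
      exact lintegral_congr fun x => (lintegral_const_mul' _ _ ENNReal.ofReal_ne_top).symm
    simp_rw [e1]
    symm
    rw [lintegral_lintegral_swap]
    · refine lintegral_congr fun x => ?_
      rw [lintegral_lintegral_swap]
      · refine lintegral_congr fun y => ?_
        rw [spatialProfile, ← lintegral_const_mul' _ _ (by finiteness)]
        exact lintegral_congr fun r => by ring
      · refine Measurable.aemeasurable ?_
        exact hM3.comp (f := fun p : ℝ × 𝔼 => ((x, p.1), p.2)) (by fun_prop)
    · refine Measurable.aemeasurable ?_
      exact hM3.lintegral_prod_right'.comp measurable_swap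
  rw [hL]
  set k : 𝔼 → ℂ := 𝓕⁻ (fun x : 𝔼 => (radialBump x : ℂ)) with hk
  have hkc : Continuous k := by
    obtain ⟨K, hK⟩ := exists_schwartz_fourierInv (contDiff_radialBump (d := d))
      hasCompactSupport_radialBump
    rw [hk, ← hK]
    exact K.continuous
  have hR : ∀ r ∈ Set.Ioi (0 : ℝ),
      W r * ∫⁻ z, (∫⁻ x, a x * ENNReal.ofReal (dilatedBump r (x - z))) ^ 2 =
      ∫⁻ ξ, ‖F ξ‖ₑ ^ 2 * (ENNReal.ofReal (r ^ (2 * s - 1)) * ‖k (r • ξ)‖ₑ ^ 2) := by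
    intro r hr
    have hr0 : 0 < r := hr
    rw [h.lintegral_sq_translate hs hf (contDiff_dilatedBump r) (hasCompactSupport_dilatedBump hr)
      (dilatedBump_nonneg r), ← lintegral_const_mul' _ _ ENNReal.ofReal_ne_top]
    refine lintegral_congr fun ξ => ?_
    rw [fourierInv_dilatedBump hr, enorm_mul, mul_pow, ← Complex.ofReal_pow,
      ← ofReal_norm ((r ^ d : ℝ) : ℂ), Complex.norm_real, Real.norm_of_nonneg (by positivity),
      ← ENNReal.ofReal_pow (by positivity), mul_left_comm, ← mul_assoc (W r),
      ← ENNReal.ofReal_mul (by positivity)]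
    congr 4
    rw [← pow_mul, ← Real.rpow_natCast, ← Real.rpow_add hr0]
    congr 1
    push_cast
    ring
  rw [setLIntegral_congr_fun measurableSet_Ioi hR, lintegral_lintegral_swap]
  · refine lintegral_congr fun ξ => ?_
    rw [lintegral_const_mul' _ _ (by finiteness)]
    rfl
  · have hF : AEMeasurable (fun ξ => ‖F ξ‖ₑ ^ 2) volume :=
      h.aestronglyMeasurable.enorm.pow_const 2
    refine (hF.comp_snd).mul (Measurable.aemeasurable ?_)
    exact (measurable_fst.pow_const _).ennreal_ofReal.mul
      ((hkc.measurable.comp (measurable_fst.smul measurable_snd)).enorm.pow_const 2)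

lemma exists_norm_eq_one (hd : 0 < d) : ∃ e : 𝔼, ‖e‖ = 1 :=
  ⟨EuclideanSpace.single ⟨0, hd⟩ 1, by simp⟩

/-- The energy identity with the two constants left as the values of the profiles at a unit vector.
They are not yet known to be finite and nonzero on the spatial side. -/
lemma IsDualFourier.lintegral_norm_rpow {s : ℝ} (hs : 0 < s ∧ s < (d : ℝ) / 2) {f : 𝔼 → ℝ}
    {F : 𝔼 → ℂ} (h : IsDualFourier s f F) (hfm : Measurable f) (hf : ∀ x, 0 ≤ f x) {e : 𝔼}
    (he : ‖e‖ = 1) :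
    (∫⁻ x, ∫⁻ y, ENNReal.ofReal (f x) * ENNReal.ofReal (f y) *
        ENNReal.ofReal (‖x - y‖ ^ (2 * s - d))) * spatialProfile s e =
      (∫⁻ ξ, ‖F ξ‖ₑ ^ 2 * ENNReal.ofReal (‖ξ‖ ^ (-(2 * s)))) * freqProfile s e := by
  have hd := pos_of_lt_half hs
  have : Nonempty (Fin d) := ⟨⟨0, hd⟩⟩
  have key := h.lintegral_profile hs hfm hf
  rw [← lintegral_mul_const _ (by fun_prop),
    ← lintegral_mul_const' _ _ (freqProfile_ne_top hs.1 he)]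
  have hR : ∫⁻ ξ, ‖F ξ‖ₑ ^ 2 * ENNReal.ofReal (‖ξ‖ ^ (-(2 * s))) * freqProfile s e =
      ∫⁻ ξ, ‖F ξ‖ₑ ^ 2 * freqProfile s ξ := by
    refine lintegral_congr_ae ?_
    filter_upwards [ae_ne_zero_of_pos hd] with ξ hξ
    rw [freqProfile_eq s he hξ]
    ring
  rw [hR, ← key]
  refine lintegral_congr fun x => ?_
  rw [← lintegral_mul_const _ (by fun_prop)]
  refine lintegral_congr_ae ?_
  have hne : ∀ᵐ y : 𝔼, y ≠ x := by simp [ae_iff]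
  filter_upwards [hne] with y hy
  rw [spatialProfile_eq s he (sub_ne_zero.2 hy.symm)]
  ring

/-! ### The constant, computed on Gaussians -/

/-- An integrable function has finite dual energy as soon as its Fourier transform lies in `L²`. -/
lemma isDualFourier_fourier {s : ℝ} (hs : 0 < s ∧ s < (d : ℝ) / 2) {f : 𝔼 → ℝ}
    (hf : Integrable f volume) (hF : MemLp (𝓕 (fun x => (f x : ℂ))) 2 volume) :
    IsDualFourier s f (𝓕 (fun x => (f x : ℂ))) where
  aestronglyMeasurable := hF.aestronglyMeasurable
  energy := integrable_symbol_inv_mul_sq hs hF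
    (fun ξ => VectorFourier.norm_fourierIntegral_le_integral_norm _ _ _ _ ξ)
  locallyIntegrable := hf.locallyIntegrable
  pairing φ hφ hc := by
    have hcc : HasCompactSupport (fun x => (φ x : ℂ)) :=
      hc.comp_left (g := fun t : ℝ => (t : ℂ)) rfl
    have hgc : ContDiff ℝ ∞ (fun x => (φ x : ℂ)) := Complex.ofRealCLM.contDiff.comp hφ
    set Φ : 𝓢(𝔼, ℂ) := hcc.toSchwartzMap hgc with hΦ
    have h1 : (𝓕⁻ (fun x => (φ x : ℂ))) = (𝓕⁻ Φ : 𝓢(𝔼, ℂ)) := by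
      rw [SchwartzMap.fourierInv_coe]; rfl
    have h2 : ∫ ξ, (𝓕 (fun x => (f x : ℂ))) ξ * (𝓕⁻ Φ : 𝓢(𝔼, ℂ)) ξ =
        ∫ x, (f x : ℂ) * (𝓕 ⇑(𝓕⁻ Φ : 𝓢(𝔼, ℂ))) x :=
      integral_fourier_mul_eq hf.ofReal (𝓕⁻ Φ : 𝓢(𝔼, ℂ)).integrable
    rw [h1, h2, ← SchwartzMap.fourier_coe, FourierTransform.fourier_fourierInv_eq]
    refine integral_ofReal.symm.trans ?_
    congr 1
    ext x
    push_cast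
    rfl

lemma lintegral_rpow_mul_gaussian {a b : ℝ} (hd : 0 < d) (ha : -(d : ℝ) < a) (hb : 0 < b) :
    ∫⁻ v : 𝔼, ENNReal.ofReal (‖v‖ ^ a * Real.exp (-b * ‖v‖ ^ 2)) =
      ENNReal.ofReal (d * volume.real (Metric.ball (0 : 𝔼) 1) *
        (b ^ (-(a + d) / 2) * (1 / 2) * Real.Gamma ((a + d) / 2))) := by
  have : Nonempty (Fin d) := ⟨⟨0, hd⟩⟩
  have key : ∀ y ∈ Set.Ioi (0 : ℝ), y ^ (Module.finrank ℝ 𝔼 - 1) •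
      (y ^ a * Real.exp (-b * y ^ 2)) = y ^ (a + d - 1) * Real.exp (-b * y ^ (2 : ℝ)) := by
    intro y hy
    have hy' : 0 < y := hy
    rw [finrank_euclideanSpace_fin, ← Real.rpow_natCast, Nat.cast_sub hd, Nat.cast_one,
      smul_eq_mul, ← mul_assoc, ← Real.rpow_add hy', Real.rpow_two]
    congr 2
    ring
  have hlt : -1 < a + d - 1 := by linarith
  rw [← ofReal_integral_eq_lintegral_ofReal]
  · rw [integral_fun_norm_addHaar volume (fun y : ℝ => y ^ a * Real.exp (-b * y ^ 2)),
      setIntegral_congr_fun measurableSet_Ioi key,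
      integral_rpow_mul_exp_neg_mul_rpow two_pos hlt hb, finrank_euclideanSpace_fin]
    simp only [sub_add_cancel, nsmul_eq_mul, smul_eq_mul]
    congr 1
    ring
  · rw [integrable_fun_norm_addHaar volume (f := fun y : ℝ => y ^ a * Real.exp (-b * y ^ 2)),
      integrableOn_congr_fun key measurableSet_Ioi]
    exact integrableOn_rpow_mul_exp_neg_mul_rpow hlt two_pos hb
  · exact ae_of_all _ fun v => by positivity

/-- The Gaussian `exp (-π ‖x‖ ^ 2)`, which is its own Fourier transform. -/
def gaussian (x : 𝔼) : ℝ := Real.exp (-Real.pi * ‖x‖ ^ 2)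

lemma ofReal_gaussian (x : 𝔼) : (gaussian x : ℂ) = Complex.exp (-Real.pi * ‖x‖ ^ 2) := by
  simp [gaussian]

lemma fourier_gaussian : 𝓕 (fun x : 𝔼 => (gaussian x : ℂ)) = fun x => (gaussian x : ℂ) := by
  ext w
  simp_rw [ofReal_gaussian]
  rw [fourier_gaussian_innerProductSpace (by simpa using Real.pi_pos)]
  have : (Real.pi : ℂ) ≠ 0 := by exact_mod_cast Real.pi_ne_zero
  rw [div_self this, Complex.one_cpow, one_mul]
  congr 1
  field_simp

lemma measurable_gaussian : Measurable (gaussian : 𝔼 → ℝ) := by unfold gaussian; fun_prop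

lemma integrable_exp_neg_mul_norm_sq {b : ℝ} (hb : 0 < b) :
    Integrable (fun x : 𝔼 => Real.exp (-b * ‖x‖ ^ 2)) volume := by
  have := (GaussianFourier.integrable_cexp_neg_mul_sq_norm_add (V := 𝔼) (b := (b : ℂ))
    (by simpa using hb) 0 0).norm
  refine this.congr (ae_of_all _ fun x => ?_)
  have e : -(b : ℂ) * (‖x‖ : ℂ) ^ 2 + 0 * (inner ℝ (0 : 𝔼) x : ℂ) =
      ((-b * ‖x‖ ^ 2 : ℝ) : ℂ) := by
    push_cast
    ring
  simp only
  rw [e, Complex.norm_exp, Complex.ofReal_re]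

lemma isDualFourier_gaussian {s : ℝ} (hs : 0 < s ∧ s < (d : ℝ) / 2) :
    IsDualFourier s (gaussian : 𝔼 → ℝ) (fun x => (gaussian x : ℂ)) := by
  have h := isDualFourier_fourier hs (f := (gaussian : 𝔼 → ℝ))
    (integrable_exp_neg_mul_norm_sq Real.pi_pos) ?_
  · rwa [fourier_gaussian] at h
  · have hm : AEStronglyMeasurable (fun x : 𝔼 => (gaussian x : ℂ)) volume :=
      (Complex.measurable_ofReal.comp measurable_gaussian).aestronglyMeasurable
    rw [fourier_gaussian, memLp_two_iff_integrable_sq_norm hm]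
    refine (integrable_exp_neg_mul_norm_sq (b := 2 * Real.pi) (by positivity)).congr
      (ae_of_all _ fun x => ?_)
    simp only [Complex.norm_real, Real.norm_eq_abs, sq_abs, gaussian]
    rw [← Real.exp_nat_mul]
    congr 1
    push_cast
    ring

lemma lintegral_gaussian_mul_translate (v : 𝔼) :
    ∫⁻ x, ENNReal.ofReal (gaussian x) * ENNReal.ofReal (gaussian (x - v)) =
      ENNReal.ofReal ((1 / 2) ^ ((d : ℝ) / 2) * Real.exp (-(Real.pi / 2) * ‖v‖ ^ 2)) := by
  have e : ∀ x : 𝔼, ENNReal.ofReal (gaussian x) * ENNReal.ofReal (gaussian (x - v)) =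
      ENNReal.ofReal (Real.exp (-(Real.pi / 2) * ‖v‖ ^ 2) *
        Real.exp (-(2 * Real.pi) * ‖x - (1 / 2 : ℝ) • v‖ ^ 2)) := by
    intro x
    rw [gaussian, gaussian, ← ENNReal.ofReal_mul (Real.exp_pos _).le, ← Real.exp_add,
      ← Real.exp_add]
    congr 2
    rw [norm_sub_sq_real, norm_sub_sq_real, inner_smul_right, norm_smul]
    norm_num
    ring
  simp_rw [e]
  rw [← ofReal_integral_eq_lintegral_ofReal, integral_const_mul,
    integral_sub_right_eq_self (fun x : 𝔼 => Real.exp (-(2 * Real.pi) * ‖x‖ ^ 2)),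
    GaussianFourier.integral_rexp_neg_mul_sq_norm (by positivity), finrank_euclideanSpace_fin,
    mul_comm]
  · congr 3
    field_simp
  · exact ((integrable_exp_neg_mul_norm_sq (b := 2 * Real.pi) (by positivity)).comp_sub_right
      _).const_mul _
  · exact ae_of_all _ fun x => by positivity

/-- The spatial side of the energy identity for the Gaussian. -/
lemma lintegral_gaussian_norm_rpow {s : ℝ} (hs : 0 < s ∧ s < (d : ℝ) / 2) :
    ∫⁻ x : 𝔼, ∫⁻ y : 𝔼, ENNReal.ofReal (gaussian x) * ENNReal.ofReal (gaussian y) *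
        ENNReal.ofReal (‖x - y‖ ^ (2 * s - d)) =
      ENNReal.ofReal (d * volume.real (Metric.ball (0 : 𝔼) 1) *
        ((1 / 2) ^ ((d : ℝ) / 2) * ((Real.pi / 2) ^ (-s) * (1 / 2) * Real.Gamma s))) := by
  have hd := pos_of_lt_half hs
  have hg : Measurable (gaussian : 𝔼 → ℝ) := measurable_gaussian
  calc ∫⁻ x : 𝔼, ∫⁻ y : 𝔼, ENNReal.ofReal (gaussian x) * ENNReal.ofReal (gaussian y) *
        ENNReal.ofReal (‖x - y‖ ^ (2 * s - d))
      = ∫⁻ x : 𝔼, ∫⁻ v : 𝔼, ENNReal.ofReal (gaussian x) * ENNReal.ofReal (gaussian (x - v)) *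
        ENNReal.ofReal (‖v‖ ^ (2 * s - d)) := by
        refine lintegral_congr fun x => ?_
        rw [← lintegral_sub_left_eq_self _ x]
        simp
    _ = ∫⁻ v : 𝔼, ∫⁻ x : 𝔼, ENNReal.ofReal (gaussian x) * ENNReal.ofReal (gaussian (x - v)) *
        ENNReal.ofReal (‖v‖ ^ (2 * s - d)) :=
        lintegral_lintegral_swap (Measurable.aemeasurable (by fun_prop))
    _ = ∫⁻ v : 𝔼, ENNReal.ofReal ((1 / 2) ^ ((d : ℝ) / 2)) *
          ENNReal.ofReal (‖v‖ ^ (2 * s - d) * Real.exp (-(Real.pi / 2) * ‖v‖ ^ 2)) := by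
        refine lintegral_congr fun v => ?_
        rw [lintegral_mul_const' _ _ ENNReal.ofReal_ne_top, lintegral_gaussian_mul_translate,
          ← ENNReal.ofReal_mul (by positivity), ← ENNReal.ofReal_mul (by positivity)]
        congr 1
        ring
    _ = _ := by
        rw [lintegral_const_mul' _ _ ENNReal.ofReal_ne_top,
          lintegral_rpow_mul_gaussian hd (by linarith [hs.1]) (by positivity),
          ← ENNReal.ofReal_mul (by positivity)]
        rw [show -(2 * s - d + d) / 2 = -s by ring, show (2 * s - d + d) / 2 = s by ring]
        congr 1
        ring

/-- The frequency side of the energy identity for the Gaussian. -/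
lemma lintegral_gaussian_sq_rpow {s : ℝ} (hs : 0 < s ∧ s < (d : ℝ) / 2) :
    ∫⁻ ξ : 𝔼, ‖(gaussian ξ : ℂ)‖ₑ ^ 2 * ENNReal.ofReal (‖ξ‖ ^ (-(2 * s))) =
      ENNReal.ofReal (d * volume.real (Metric.ball (0 : 𝔼) 1) *
        ((2 * Real.pi) ^ (-((d - 2 * s) / 2)) * (1 / 2) * Real.Gamma ((d - 2 * s) / 2))) := by
  have hd := pos_of_lt_half hs
  have e : ∀ ξ : 𝔼, ‖(gaussian ξ : ℂ)‖ₑ ^ 2 * ENNReal.ofReal (‖ξ‖ ^ (-(2 * s))) =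
      ENNReal.ofReal (‖ξ‖ ^ (-(2 * s)) * Real.exp (-(2 * Real.pi) * ‖ξ‖ ^ 2)) := by
    intro ξ
    rw [← ofReal_norm (gaussian ξ : ℂ), ← ENNReal.ofReal_pow (norm_nonneg _),
      ← ENNReal.ofReal_mul (by positivity), mul_comm, Complex.norm_real, Real.norm_eq_abs, sq_abs,
      gaussian, ← Real.exp_nat_mul]
    congr 3
    push_cast
    ring
  simp_rw [e]
  rw [lintegral_rpow_mul_gaussian hd (by linarith [hs.2]) (by positivity)]
  rw [show -(-(2 * s) + d) / 2 = -(((d : ℝ) - 2 * s) / 2) by ring,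
    show (-(2 * s) + (d : ℝ)) / 2 = (d - 2 * s) / 2 by ring]

/-- The ratio of the two profiles, read off from the energy identity for the Gaussian, both sides of
which are explicit. -/
lemma freqProfile_eq_mul_spatialProfile {s : ℝ} (hs : 0 < s ∧ s < (d : ℝ) / 2) {e : 𝔼}
    (he : ‖e‖ = 1) :
    spatialProfile s e ≠ 0 ∧ spatialProfile s e ≠ ⊤ ∧
    freqProfile s e = ENNReal.ofReal (Real.pi ^ ((d : ℝ) / 2 - 2 * s) * Real.Gamma s /
      Real.Gamma ((d - 2 * s) / 2)) * spatialProfile s e := by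
  have hd := pos_of_lt_half hs
  have hd' : (0 : ℝ) < d := by exact_mod_cast hd
  have hds : 0 < ((d : ℝ) - 2 * s) / 2 := by linarith [hs.2]
  have hB : 0 < volume.real (Metric.ball (0 : 𝔼) 1) :=
    ENNReal.toReal_pos (Metric.measure_ball_pos _ _ one_pos).ne' measure_ball_lt_top.ne
  have hG1 := Real.Gamma_pos_of_pos hs.1
  have hG2 := Real.Gamma_pos_of_pos hds
  have key := (isDualFourier_gaussian hs).lintegral_norm_rpow hs measurable_gaussian
    (fun x => (Real.exp_pos _).le) he
  rw [lintegral_gaussian_norm_rpow hs, lintegral_gaussian_sq_rpow hs] at key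
  set M1 : ℝ := d * volume.real (Metric.ball (0 : 𝔼) 1) *
        ((1 / 2) ^ ((d : ℝ) / 2) * ((Real.pi / 2) ^ (-s) * (1 / 2) * Real.Gamma s)) with hM1
  set M2 : ℝ := d * volume.real (Metric.ball (0 : 𝔼) 1) *
        ((2 * Real.pi) ^ (-(((d : ℝ) - 2 * s) / 2)) * (1 / 2) *
          Real.Gamma ((d - 2 * s) / 2)) with hM2
  have h1 : 0 < M1 := by positivity
  have h2 : 0 < M2 := by positivity
  have hJ0 := freqProfile_ne_zero s e
  have hJt := freqProfile_ne_top hs.1 he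
  have hM10 : ENNReal.ofReal M1 ≠ 0 := (ENNReal.ofReal_pos.2 h1).ne'
  have hM20 : ENNReal.ofReal M2 ≠ 0 := (ENNReal.ofReal_pos.2 h2).ne'
  refine ⟨fun h0 => ?_, fun ht => ?_, ?_⟩
  · rw [h0, mul_zero] at key
    exact mul_ne_zero hM20 hJ0 key.symm
  · rw [ht, ENNReal.mul_top hM10] at key
    exact ENNReal.mul_ne_top ENNReal.ofReal_ne_top hJt key.symm
  · have hratio : Real.pi ^ ((d : ℝ) / 2 - 2 * s) * Real.Gamma s / Real.Gamma ((d - 2 * s) / 2) =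
        M2⁻¹ * M1 := by
      have hpi := Real.pi_pos
      have e1 : (1 / 2 : ℝ) ^ ((d : ℝ) / 2) * (Real.pi / 2) ^ (-s) =
          Real.pi ^ ((d : ℝ) / 2 - 2 * s) * (2 * Real.pi) ^ (-(((d : ℝ) - 2 * s) / 2)) := by
        have e0 : (1 / 2 : ℝ) ^ ((d : ℝ) / 2) = 2 ^ (-((d : ℝ) / 2)) := by
          rw [one_div, Real.inv_rpow two_pos.le, Real.rpow_neg two_pos.le]
        have e0' : (Real.pi / 2) ^ (-s) = Real.pi ^ (-s) * 2 ^ s := by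
          rw [Real.div_rpow hpi.le two_pos.le, Real.rpow_neg two_pos.le s, div_inv_eq_mul]
        have e2 : (2 : ℝ) ^ (-((d : ℝ) / 2)) * (Real.pi ^ (-s) * 2 ^ s) =
            Real.pi ^ (-s) * (2 ^ (-((d : ℝ) / 2)) * 2 ^ s) := by ring
        have e3 : Real.pi ^ ((d : ℝ) / 2 - 2 * s) * (2 ^ (-(((d : ℝ) - 2 * s) / 2)) *
            Real.pi ^ (-(((d : ℝ) - 2 * s) / 2))) = (Real.pi ^ ((d : ℝ) / 2 - 2 * s) *
            Real.pi ^ (-(((d : ℝ) - 2 * s) / 2))) * 2 ^ (-(((d : ℝ) - 2 * s) / 2)) := by ring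
        rw [e0, e0', e2, Real.mul_rpow two_pos.le hpi.le, e3, ← Real.rpow_add two_pos,
          ← Real.rpow_add hpi]
        congr 2 <;> ring
      rw [eq_inv_mul_iff_mul_eq₀ h2.ne', hM1, hM2,
        show (1 / 2 : ℝ) ^ ((d : ℝ) / 2) * ((Real.pi / 2) ^ (-s) * (1 / 2) * Real.Gamma s) =
          ((1 / 2 : ℝ) ^ ((d : ℝ) / 2) * (Real.pi / 2) ^ (-s)) * ((1 / 2) * Real.Gamma s) by ring,
        e1]
      field_simp
    rw [hratio, ENNReal.ofReal_mul (by positivity), mul_assoc, key, ← mul_assoc,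
      ← ENNReal.ofReal_mul (by positivity), inv_mul_cancel₀ h2.ne', ENNReal.ofReal_one, one_mul]

/-- The energy identity: for `f ≥ 0` the Riesz energy of `f` is `∫ (2π|ξ|)^{-2s} |F(ξ)|² dξ`. -/
theorem IsDualFourier.lintegral_rieszKernel {s : ℝ} (hs : 0 < s ∧ s < (d : ℝ) / 2) {f : 𝔼 → ℝ}
    {F : 𝔼 → ℂ} (h : IsDualFourier s f F) (hfm : Measurable f) (hf : ∀ x, 0 ≤ f x) :
    ∫⁻ x, ∫⁻ y, ENNReal.ofReal (f x) * ENNReal.ofReal (f y) *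
        ENNReal.ofReal (rieszKernel (2 * s) (x - y)) =
      ENNReal.ofReal (∫ ξ, (symbol s ξ)⁻¹ * ‖F ξ‖ ^ 2) := by
  obtain ⟨e, he⟩ := exists_norm_eq_one (pos_of_lt_half hs)
  have hds : 0 < ((d : ℝ) - 2 * s) / 2 := by linarith [hs.2]
  have hG1 := Real.Gamma_pos_of_pos hs.1
  have hG2 := Real.Gamma_pos_of_pos hds
  have hpi := Real.pi_pos
  obtain ⟨hH0, hHt, hJ⟩ := freqProfile_eq_mul_spatialProfile hs he
  have key := h.lintegral_norm_rpow hs hfm hf he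
  rw [hJ, ← mul_assoc, ENNReal.mul_left_inj hH0 hHt] at key
  set A : ℝ := Real.Gamma ((d - 2 * s) / 2) / (Real.pi ^ ((d : ℝ) / 2) * 2 ^ (2 * s) *
    Real.Gamma (2 * s / 2)) with hA
  have h2s : 2 * s / 2 = s := by ring
  have hA0 : 0 < A := by rw [hA, h2s]; positivity
  have e1 : ∀ v : 𝔼, ENNReal.ofReal (rieszKernel (2 * s) v) =
      ENNReal.ofReal A * ENNReal.ofReal (‖v‖ ^ (2 * s - d)) := fun v => by
    rw [← ENNReal.ofReal_mul hA0.le]; rfl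
  have e2 : ∫⁻ x, ∫⁻ y, ENNReal.ofReal (f x) * ENNReal.ofReal (f y) *
        ENNReal.ofReal (rieszKernel (2 * s) (x - y)) =
      ENNReal.ofReal A * ∫⁻ x, ∫⁻ y, ENNReal.ofReal (f x) * ENNReal.ofReal (f y) *
        ENNReal.ofReal (‖x - y‖ ^ (2 * s - d)) := by
    rw [← lintegral_const_mul' _ _ ENNReal.ofReal_ne_top]
    refine lintegral_congr fun x => ?_
    rw [← lintegral_const_mul' _ _ ENNReal.ofReal_ne_top]
    refine lintegral_congr fun y => ?_
    rw [e1]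
    ring
  have hconst : A * (Real.pi ^ ((d : ℝ) / 2 - 2 * s) * Real.Gamma s /
      Real.Gamma ((d - 2 * s) / 2)) = (2 * Real.pi) ^ (-(2 * s)) := by
    rw [hA, h2s, Real.rpow_sub hpi, Real.rpow_neg (by positivity),
      Real.mul_rpow two_pos.le hpi.le]
    field_simp
  rw [e2, key, mul_comm (∫⁻ ξ, _), ← mul_assoc, ← ENNReal.ofReal_mul hA0.le, hconst,
    ofReal_integral_eq_lintegral_ofReal h.energy
      (ae_of_all _ fun ξ => mul_nonneg (inv_nonneg.2 (symbol_nonneg s ξ)) (sq_nonneg _)),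
    ← lintegral_const_mul' _ _ ENNReal.ofReal_ne_top]
  refine lintegral_congr fun ξ => ?_
  rw [← ofReal_norm, ← ENNReal.ofReal_pow (norm_nonneg _), ← ENNReal.ofReal_mul (by positivity),
    ← ENNReal.ofReal_mul (by positivity)]
  congr 1
  rw [symbol, Real.mul_rpow (by positivity) (norm_nonneg _), Real.rpow_neg (by positivity),
    Real.rpow_neg (norm_nonneg _), mul_inv]
  ring

/-! ### The Fourier transform of an element of the dual space -/

lemma IsDualFourier.add {s : ℝ} {f g : 𝔼 → ℝ} {F G : 𝔼 → ℂ}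
    (hF : IsDualFourier s f F) (hG : IsDualFourier s g G) (hs : 0 < s ∧ s < (d : ℝ) / 2) :
    IsDualFourier s (fun x => f x + g x) (fun ξ => F ξ + G ξ) where
  aestronglyMeasurable := hF.aestronglyMeasurable.add hG.aestronglyMeasurable
  energy := by
    refine ((hF.energy.const_mul 2).add (hG.energy.const_mul 2)).mono' ?_ (ae_of_all _ fun ξ => ?_)
    · exact (measurable_symbol s).inv.aestronglyMeasurable.mul
        ((hF.aestronglyMeasurable.add hG.aestronglyMeasurable).norm.pow 2)
    · have h0 := inv_nonneg.2 (symbol_nonneg s ξ)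
      rw [Real.norm_of_nonneg (by positivity)]
      have h1 : ‖F ξ + G ξ‖ ^ 2 ≤ 2 * ‖F ξ‖ ^ 2 + 2 * ‖G ξ‖ ^ 2 := by
        have := norm_add_le (F ξ) (G ξ)
        nlinarith [norm_nonneg (F ξ + G ξ), sq_nonneg (‖F ξ‖ - ‖G ξ‖)]
      calc (symbol s ξ)⁻¹ * ‖F ξ + G ξ‖ ^ 2
          ≤ (symbol s ξ)⁻¹ * (2 * ‖F ξ‖ ^ 2 + 2 * ‖G ξ‖ ^ 2) := by gcongr
        _ = _ := by simp only [Pi.add_apply]; ring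
  locallyIntegrable := hF.locallyIntegrable.add hG.locallyIntegrable
  pairing φ hφ hc := by
    have i : ∀ {f : 𝔼 → ℝ}, LocallyIntegrable f volume →
        Integrable (fun x => f x * φ x) volume := by
      intro f hf
      have := hf.integrable_smul_left_of_hasCompactSupport hφ.continuous hc
      simpa [mul_comm] using! this
    simp only [add_mul]
    rw [integral_add (i hF.locallyIntegrable) (i hG.locallyIntegrable),
      integral_add (hF.mul_schwartz hs hφ hc).1 (hG.mul_schwartz hs hφ hc).1,
      Complex.ofReal_add, hF.pairing φ hφ hc, hG.pairing φ hφ hc]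

lemma symbol_inv_mul_sq (s : ℝ) (ξ : 𝔼) (z : ℂ) :
    (symbol s ξ)⁻¹ * ‖(symbol s ξ : ℂ) * z‖ ^ 2 = symbol s ξ * ‖z‖ ^ 2 := by
  rw [norm_mul, Complex.norm_real, Real.norm_of_nonneg (symbol_nonneg s ξ)]
  by_cases h : symbol s ξ = 0
  · simp [h]
  · field_simp

section Representative
variable {s : ℝ} [hs : Fact (0 < s ∧ s < (d : ℝ) / 2)]

lemma HomSobolev.fourier_ofTest {φ : 𝔼 → ℝ} (hφ : ContDiff ℝ ∞ φ) (hc : HasCompactSupport φ) :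
    (HomSobolev.ofTest φ hφ hc : HomSobolev d s).fourier =ᵐ[volume] 𝓕 (fun x => (φ x : ℂ)) := by
  refine (HomSobolev.ofTest φ hφ hc : HomSobolev d s).isSobolevFourier.ae_unique ?_
  have h := HomSobolev.isSobolevFourier_test (s := s) hφ hc
  refine ⟨h.locallyIntegrable, h.energy, fun ψ => ?_⟩
  rw [h.pairing ψ]
  refine integral_congr_ae ?_
  filter_upwards [HomSobolev.ofTest_ae_eq (s := s) φ hφ hc] with x hx
  rw [hx]

/-- If `U` is the Riesz representative of `T`, then `(2π|ξ|)^{2s} Û` is the Fourier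
transform of `T`. It pairs with test functions to real numbers because `Û` is Hermitian. -/
lemma isDualFourier_of_isRieszRepresentative {T : StrongDual ℝ (HomSobolev d s)} {t : 𝔼 → ℝ}
    (ht : LocallyIntegrable t volume) (hT : IsRegularDistribution T t) {U : HomSobolev d s}
    (hU : IsRieszRepresentative T U) :
    IsDualFourier s t (fun ξ => (symbol s ξ : ℂ) * U.fourier ξ) where
  aestronglyMeasurable :=
    (Complex.measurable_ofReal.comp (measurable_symbol s)).aestronglyMeasurable.mul
      U.isSobolevFourier.locallyIntegrable.aestronglyMeasurable
  energy := by
    simp_rw [symbol_inv_mul_sq]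
    exact U.isSobolevFourier.energy
  locallyIntegrable := ht
  pairing φ hφ hc := by
    have hUm := U.isSobolevFourier.locallyIntegrable.aestronglyMeasurable
    have hφF := HomSobolev.isSobolevFourier_test (s := s) hφ hc
    have hi : Integrable (fun ξ => (symbol s ξ : ℂ) * U.fourier ξ *
        (𝓕⁻ (fun x => (φ x : ℂ))) ξ) volume := by
      refine (U.isSobolevFourier.energy.add hφF.energy).mono' ?_ (ae_of_all _ fun ξ => ?_)
      · refine ((Complex.measurable_ofReal.comp (measurable_symbol s)).aestronglyMeasurable.mul
          hUm).mul ?_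
        obtain ⟨k, hk⟩ := exists_schwartz_fourierInv hφ hc
        rw [← hk]
        exact k.continuous.aestronglyMeasurable
      · have h0 := symbol_nonneg s ξ
        rw [← conj_fourier_ofReal, norm_mul, norm_mul, RCLike.norm_conj, Complex.norm_real,
          Real.norm_of_nonneg h0]
        calc symbol s ξ * ‖U.fourier ξ‖ * ‖(𝓕 (fun x => (φ x : ℂ))) ξ‖
            = symbol s ξ * (‖U.fourier ξ‖ * ‖(𝓕 (fun x => (φ x : ℂ))) ξ‖) := by ring
          _ ≤ symbol s ξ * (‖U.fourier ξ‖ ^ 2 + ‖(𝓕 (fun x => (φ x : ℂ))) ξ‖ ^ 2) := by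
            gcongr
            nlinarith [sq_nonneg (‖U.fourier ξ‖ - ‖(𝓕 (fun x => (φ x : ℂ))) ξ‖),
              sq_nonneg (‖U.fourier ξ‖), sq_nonneg (‖(𝓕 (fun x => (φ x : ℂ))) ξ‖)]
          _ = _ := by simp only [Pi.add_apply]; ring
    set X : ℂ := ∫ ξ, (symbol s ξ : ℂ) * U.fourier ξ * (𝓕⁻ (fun x => (φ x : ℂ))) ξ with hX
    have hre : ∫ x, t x * φ x = X.re := by
      rw [← hT φ hφ hc, hU, HomSobolev.inner_eq, HomSobolev.innerProd, hX]
      have := (integral_re hi).symm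
      refine Eq.trans ?_ this.symm
      refine integral_congr_ae ?_
      filter_upwards [HomSobolev.fourier_ofTest (s := s) hφ hc] with ξ hξ
      rw [hξ, conj_fourier_ofReal, mul_assoc]
      simp
    have hconj : conj X = X := by
      rw [hX, ← integral_conj, ← integral_neg_eq_self]
      refine integral_congr_ae ?_
      filter_upwards [U.isSobolevFourier.conj_neg] with ξ hξ
      rw [map_mul, map_mul, hξ, conj_fourierInv_ofReal, Complex.conj_ofReal,
        Real.fourierInv_eq_fourier_neg]
      simp [symbol]
    rw [hre]
    exact Complex.conj_eq_iff_re.1 hconj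

/-- Expansion of the dual energy of `T + ψ`. In the cross term the weights cancel, and
`∫ Û 𝓕⁻ψ = ∫ U ψ`. -/
lemma integral_energy_add {U : HomSobolev d s} {ψ : 𝔼 → ℝ} (hψ : ContDiff ℝ ∞ ψ)
    (hc : HasCompactSupport ψ) :
    ∫ ξ, (symbol s ξ)⁻¹ * ‖(symbol s ξ : ℂ) * U.fourier ξ + (𝓕 (fun x => (ψ x : ℂ))) ξ‖ ^ 2 =
      (∫ ξ, (symbol s ξ)⁻¹ * ‖(symbol s ξ : ℂ) * U.fourier ξ‖ ^ 2) +
      2 * (∫ x, U x * ψ x) + ∫ ξ, (symbol s ξ)⁻¹ * ‖(𝓕 (fun x => (ψ x : ℂ))) ξ‖ ^ 2 := by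
  have hd := pos_of_lt_half hs.out
  have hcc : HasCompactSupport (fun x => (ψ x : ℂ)) :=
    hc.comp_left (g := fun t : ℝ => (t : ℂ)) rfl
  have hgc : ContDiff ℝ ∞ (fun x => (ψ x : ℂ)) := Complex.ofRealCLM.contDiff.comp hψ
  set Ψ : 𝓢(𝔼, ℂ) := hcc.toSchwartzMap hgc with hΨ
  have h1 : (𝓕⁻ (fun x => (ψ x : ℂ))) = (𝓕⁻ Ψ : 𝓢(𝔼, ℂ)) := by
    rw [SchwartzMap.fourierInv_coe]; rfl
  have h2 : (𝓕 (fun x => (ψ x : ℂ))) = (𝓕 Ψ : 𝓢(𝔼, ℂ)) := by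
    rw [SchwartzMap.fourier_coe]; rfl
  have i1 : Integrable (fun ξ => (symbol s ξ)⁻¹ * ‖(symbol s ξ : ℂ) * U.fourier ξ‖ ^ 2) := by
    simp_rw [symbol_inv_mul_sq]
    exact U.isSobolevFourier.energy
  have i2 : Integrable (fun ξ => (symbol s ξ)⁻¹ * ‖(𝓕 (fun x => (ψ x : ℂ))) ξ‖ ^ 2) := by
    rw [h2]
    exact integrable_symbol_inv_mul_sq hs.out ((𝓕 Ψ : 𝓢(𝔼, ℂ)).memLp 2 volume)
      ((𝓕 Ψ : 𝓢(𝔼, ℂ)).norm_le_seminorm ℝ)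
  have i3 : Integrable (fun ξ => U.fourier ξ * (𝓕⁻ Ψ : 𝓢(𝔼, ℂ)) ξ) :=
    U.isSobolevFourier.integrable_mul hs.out.1 _
  have e3 : ∫ ξ, (U.fourier ξ * (𝓕⁻ Ψ : 𝓢(𝔼, ℂ)) ξ).re = ∫ x, U x * ψ x := by
    have hp := U.isSobolevFourier.pairing (𝓕⁻ Ψ)
    rw [FourierTransform.fourier_fourierInv_eq] at hp
    have hr : ∫ x, (U x : ℂ) * Ψ x = ((∫ x, U x * ψ x : ℝ) : ℂ) := by
      refine Eq.trans ?_ integral_ofReal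
      congr 1
      ext x
      push_cast
      rfl
    have := integral_re i3
    refine this.trans ?_
    rw [hp, hr]
    rfl
  have i4 : Integrable (fun ξ => 2 * (U.fourier ξ * (𝓕⁻ Ψ : 𝓢(𝔼, ℂ)) ξ).re) := i3.re.const_mul 2
  have i5 : Integrable (fun ξ => (symbol s ξ)⁻¹ * ‖(symbol s ξ : ℂ) * U.fourier ξ‖ ^ 2 +
      2 * (U.fourier ξ * (𝓕⁻ Ψ : 𝓢(𝔼, ℂ)) ξ).re) := i1.add i4
  rw [← e3, ← integral_const_mul, ← integral_add i1 i4, ← integral_add i5 i2]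
  refine integral_congr_ae ?_
  filter_upwards [ae_ne_zero_of_pos hd] with ξ hξ
  have hsy := symbol_pos (s := s) hξ
  rw [← h1, ← conj_fourier_ofReal, ← Complex.normSq_eq_norm_sq, Complex.normSq_add,
    Complex.normSq_eq_norm_sq, Complex.normSq_eq_norm_sq, mul_assoc (symbol s ξ : ℂ),
    Complex.re_ofReal_mul]
  field_simp
  ring

end Representative

/-! ### The Riesz potential -/

lemma rieszKernel_nonneg {s : ℝ} (hs : 0 < s ∧ s < (d : ℝ) / 2) (v : 𝔼) :
    0 ≤ rieszKernel (2 * s) v := by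
  have h1 := Real.Gamma_pos_of_pos (show 0 < ((d : ℝ) - 2 * s) / 2 by linarith [hs.2])
  have h2 := Real.Gamma_pos_of_pos (show 0 < 2 * s / 2 by linarith [hs.1])
  unfold rieszKernel
  positivity

lemma measurable_rieszKernel (α : ℝ) : Measurable (rieszKernel α : 𝔼 → ℝ) := by
  unfold rieszKernel; fun_prop

lemma rieszKernel_sub_comm (α : ℝ) (x y : 𝔼) : rieszKernel α (x - y) = rieszKernel α (y - x) := by
  rw [rieszKernel, rieszKernel, norm_sub_rev]

/-- The Riesz potential of a nonnegative function, as an extended nonnegative number. -/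
def lrieszPotential (α : ℝ) (t : 𝔼 → ℝ) (y : 𝔼) : ℝ≥0∞ :=
  ∫⁻ x, ENNReal.ofReal (rieszKernel α (y - x) * t x)

section Potential
variable {s : ℝ}

lemma measurable_lrieszPotential {α : ℝ} {t : 𝔼 → ℝ} (ht : Measurable t) :
    Measurable (lrieszPotential α t) := by
  have := measurable_rieszKernel (d := d) α
  unfold lrieszPotential
  refine Measurable.lintegral_prod_right' (f := fun q : 𝔼 × 𝔼 =>
    ENNReal.ofReal (rieszKernel α (q.1 - q.2) * t q.2)) ?_
  fun_prop

lemma rieszPotential_eq_toReal (hs : 0 < s ∧ s < (d : ℝ) / 2) {t : 𝔼 → ℝ} (ht : Measurable t)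
    (ht0 : ∀ x, 0 ≤ t x) (y : 𝔼) :
    rieszPotential (2 * s) t y = (lrieszPotential (2 * s) t y).toReal := by
  have := measurable_rieszKernel (d := d) (2 * s)
  rw [rieszPotential, lrieszPotential, integral_eq_lintegral_of_nonneg_ae]
  · exact ae_of_all _ fun x => mul_nonneg (rieszKernel_nonneg hs _) (ht0 x)
  · exact Measurable.aestronglyMeasurable (by fun_prop)

lemma integrable_rieszKernel_mul (hs : 0 < s ∧ s < (d : ℝ) / 2) {t : 𝔼 → ℝ} (ht : Measurable t)
    (ht0 : ∀ x, 0 ≤ t x) {y : 𝔼} (hy : lrieszPotential (2 * s) t y < ⊤) :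
    Integrable (fun x => rieszKernel (2 * s) (y - x) * t x) volume := by
  have := measurable_rieszKernel (d := d) (2 * s)
  refine ⟨Measurable.aestronglyMeasurable (by fun_prop), ?_⟩
  rw [hasFiniteIntegral_iff_ofReal]
  · exact hy
  · exact ae_of_all _ fun x => mul_nonneg (rieszKernel_nonneg hs _) (ht0 x)

/-- The interaction energy of nonnegative functions as an extended nonnegative number. -/
def linteraction (α : ℝ) (f g : 𝔼 → ℝ) : ℝ≥0∞ :=
  ∫⁻ x, ∫⁻ y, ENNReal.ofReal (f x) * ENNReal.ofReal (g y) * ENNReal.ofReal (rieszKernel α (x - y))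

lemma linteraction_comm {α : ℝ} {f g : 𝔼 → ℝ} (hf : Measurable f) (hg : Measurable g) :
    linteraction α f g = linteraction α g f := by
  have := measurable_rieszKernel (d := d) α
  rw [linteraction, lintegral_lintegral_swap (Measurable.aemeasurable (by fun_prop)), linteraction]
  refine lintegral_congr fun x => lintegral_congr fun y => ?_
  rw [rieszKernel_sub_comm, mul_comm (ENNReal.ofReal (f y))]

lemma linteraction_add_right {α : ℝ} {f g h : 𝔼 → ℝ} (hf : Measurable f) (hg : Measurable g)
    (hg0 : ∀ x, 0 ≤ g x) (hh0 : ∀ x, 0 ≤ h x) :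
    linteraction α f (fun x => g x + h x) = linteraction α f g + linteraction α f h := by
  have := measurable_rieszKernel (d := d) α
  have hm : Measurable fun x => ∫⁻ y, ENNReal.ofReal (f x) * ENNReal.ofReal (g y) *
      ENNReal.ofReal (rieszKernel α (x - y)) := by
    refine Measurable.lintegral_prod_right' (f := fun q : 𝔼 × 𝔼 => ENNReal.ofReal (f q.1) *
      ENNReal.ofReal (g q.2) * ENNReal.ofReal (rieszKernel α (q.1 - q.2))) ?_
    fun_prop
  rw [linteraction, linteraction, linteraction, ← lintegral_add_left hm]
  refine lintegral_congr fun x => ?_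
  rw [← lintegral_add_left (by fun_prop)]
  refine lintegral_congr fun y => ?_
  rw [ENNReal.ofReal_add (hg0 y) (hh0 y)]
  ring

lemma linteraction_eq_lintegral_potential (hs : 0 < s ∧ s < (d : ℝ) / 2) {t g : 𝔼 → ℝ} :
    linteraction (2 * s) g t = ∫⁻ y, lrieszPotential (2 * s) t y * ENNReal.ofReal (g y) := by
  refine lintegral_congr fun y => ?_
  rw [lrieszPotential, ← lintegral_mul_const' _ _ ENNReal.ofReal_ne_top]
  refine lintegral_congr fun x => ?_
  rw [ENNReal.ofReal_mul (rieszKernel_nonneg hs _)]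
  ring

end Potential

section Main
variable {s : ℝ} [hs : Fact (0 < s ∧ s < (d : ℝ) / 2)]

/-- The energy identity for `t`, `ψ` and `t + ψ`, polarized. -/
lemma linteraction_test {t : 𝔼 → ℝ} (ht : Measurable t) (ht0 : ∀ x, 0 ≤ t x) {U : HomSobolev d s}
    (h : IsDualFourier s t (fun ξ => (symbol s ξ : ℂ) * U.fourier ξ)) {ψ : 𝔼 → ℝ}
    (hψ : ContDiff ℝ ∞ ψ) (hc : HasCompactSupport ψ) (hψ0 : ∀ x, 0 ≤ ψ x) :
    linteraction (2 * s) ψ t ≠ ⊤ ∧ (linteraction (2 * s) ψ t).toReal = ∫ x, U x * ψ x := by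
  have hψm : Measurable ψ := hψ.continuous.measurable
  have hcc : HasCompactSupport (fun x => (ψ x : ℂ)) :=
    hc.comp_left (g := fun t : ℝ => (t : ℂ)) rfl
  have hgc : ContDiff ℝ ∞ (fun x => (ψ x : ℂ)) := Complex.ofRealCLM.contDiff.comp hψ
  have hψF : IsDualFourier s ψ (𝓕 (fun x => (ψ x : ℂ))) :=
    isDualFourier_fourier hs.out (hψ.continuous.integrable_of_hasCompactSupport hc)
      ((𝓕 (hcc.toSchwartzMap hgc) : 𝓢(𝔼, ℂ)).memLp 2 volume)
  have e1 : linteraction (2 * s) t t = _ := h.lintegral_rieszKernel hs.out ht ht0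
  have e2 : linteraction (2 * s) ψ ψ = _ := hψF.lintegral_rieszKernel hs.out hψm hψ0
  have hm3 : Measurable fun x => t x + ψ x := ht.add hψm
  have e3 : linteraction (2 * s) (fun x => t x + ψ x) (fun x => t x + ψ x) = _ :=
    (h.add hψF hs.out).lintegral_rieszKernel hs.out hm3 (fun x => add_nonneg (ht0 x) (hψ0 x))
  rw [linteraction_add_right hm3 ht ht0 hψ0, linteraction_comm hm3 ht, linteraction_comm hm3 hψm,
    linteraction_add_right ht ht ht0 hψ0, linteraction_add_right hψm ht ht0 hψ0,
    linteraction_comm ht hψm] at e3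
  have hnn : ∀ G : 𝔼 → ℂ, 0 ≤ ∫ ξ, (symbol s ξ)⁻¹ * ‖G ξ‖ ^ 2 := fun G =>
    integral_nonneg fun ξ => mul_nonneg (inv_nonneg.2 (symbol_nonneg s ξ)) (sq_nonneg _)
  have hD : linteraction (2 * s) ψ t ≠ ⊤ := by
    intro hD
    rw [hD] at e3
    simp at e3
  refine ⟨hD, ?_⟩
  have e4 := congrArg ENNReal.toReal e3
  rw [e1, e2, ENNReal.toReal_ofReal (hnn _), integral_energy_add hψ hc,
    ENNReal.toReal_add (by finiteness) (by finiteness),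
    ENNReal.toReal_add (by finiteness) (by finiteness),
    ENNReal.toReal_add (by finiteness) (by finiteness), ENNReal.toReal_ofReal (hnn _),
    ENNReal.toReal_ofReal (hnn _)] at e4
  linarith

/-- A smooth cut-off equal to one on a given ball. -/
lemma exists_cutoff (R : ℝ) : ∃ χ : 𝔼 → ℝ, ContDiff ℝ ∞ χ ∧ HasCompactSupport χ ∧
    (∀ x, 0 ≤ χ x) ∧ ∀ x ∈ Metric.closedBall (0 : 𝔼) R, χ x = 1 := by
  let f : ContDiffBump (0 : 𝔼) := ⟨|R| + 1, |R| + 2, by positivity, by linarith⟩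
  refine ⟨f, f.contDiff, f.hasCompactSupport, fun x => f.nonneg, fun x hx => ?_⟩
  refine f.one_of_mem_closedBall (Metric.closedBall_subset_closedBall ?_ hx)
  change R ≤ |R| + 1
  linarith [le_abs_self R]

/-- The Riesz potential is integrable on balls: its pairing with a cut-off function is finite. -/
lemma setLIntegral_lrieszPotential_ne_top {t : 𝔼 → ℝ} (ht : Measurable t) (ht0 : ∀ x, 0 ≤ t x)
    {U : HomSobolev d s} (h : IsDualFourier s t (fun ξ => (symbol s ξ : ℂ) * U.fourier ξ)) (R : ℝ) :
    ∫⁻ y in Metric.closedBall (0 : 𝔼) R, lrieszPotential (2 * s) t y ≠ ⊤ := by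
  obtain ⟨χ, hχ, hc, h0, h1⟩ := exists_cutoff (d := d) R
  refine ne_top_of_le_ne_top (linteraction_test ht ht0 h hχ hc h0).1 ?_
  rw [linteraction_eq_lintegral_potential hs.out]
  refine le_trans ?_ (setLIntegral_le_lintegral (Metric.closedBall 0 R) _)
  refine setLIntegral_mono' measurableSet_closedBall fun y hy => ?_
  rw [h1 y hy, ENNReal.ofReal_one, mul_one]

lemma ae_lrieszPotential_lt_top {t : 𝔼 → ℝ} (ht : Measurable t) (ht0 : ∀ x, 0 ≤ t x)
    {U : HomSobolev d s} (h : IsDualFourier s t (fun ξ => (symbol s ξ : ℂ) * U.fourier ξ)) :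
    ∀ᵐ y, lrieszPotential (2 * s) t y < ⊤ := by
  have h1 : ∀ n : ℕ, ∀ᵐ y, y ∈ Metric.closedBall (0 : 𝔼) n → lrieszPotential (2 * s) t y < ⊤ :=
    fun n => (ae_restrict_iff' measurableSet_closedBall).1 (ae_lt_top
      (measurable_lrieszPotential ht) (setLIntegral_lrieszPotential_ne_top ht ht0 h n))
  filter_upwards [ae_all_iff.2 h1] with y hy
  obtain ⟨n, hn⟩ := exists_nat_ge ‖y‖
  exact hy n (by simpa using hn)

lemma locallyIntegrable_toReal_lrieszPotential {t : 𝔼 → ℝ} (ht : Measurable t) (ht0 : ∀ x, 0 ≤ t x)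
    {U : HomSobolev d s} (h : IsDualFourier s t (fun ξ => (symbol s ξ : ℂ) * U.fourier ξ)) :
    LocallyIntegrable (fun y => (lrieszPotential (2 * s) t y).toReal) volume := by
  rw [locallyIntegrable_iff]
  intro K hK
  obtain ⟨R, hR⟩ := hK.isBounded.subset_closedBall 0
  refine IntegrableOn.mono_set ?_ hR
  exact integrable_toReal_of_lintegral_ne_top (measurable_lrieszPotential ht).aemeasurable
    (setLIntegral_lrieszPotential_ne_top ht ht0 h R)

lemma integral_lrieszPotential_mul_of_nonneg {t : 𝔼 → ℝ} (ht : Measurable t) (ht0 : ∀ x, 0 ≤ t x)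
    {U : HomSobolev d s} (h : IsDualFourier s t (fun ξ => (symbol s ξ : ℂ) * U.fourier ξ))
    {ψ : 𝔼 → ℝ} (hψ : ContDiff ℝ ∞ ψ) (hc : HasCompactSupport ψ) (hψ0 : ∀ x, 0 ≤ ψ x) :
    ∫ y, ψ y * (lrieszPotential (2 * s) t y).toReal = ∫ y, ψ y * U y := by
  have h1 := (linteraction_test ht ht0 h hψ hc hψ0).2
  simp_rw [mul_comm (ψ _)]
  rw [← h1, linteraction_eq_lintegral_potential hs.out, integral_eq_lintegral_of_nonneg_ae]
  · congr 1
    refine lintegral_congr_ae ?_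
    filter_upwards [ae_lrieszPotential_lt_top ht ht0 h] with y hy
    rw [ENNReal.ofReal_mul ENNReal.toReal_nonneg, ENNReal.ofReal_toReal hy.ne]
  · exact ae_of_all _ fun y => mul_nonneg ENNReal.toReal_nonneg (hψ0 y)
  · exact ((measurable_lrieszPotential ht).ennreal_toReal.mul
      hψ.continuous.measurable).aestronglyMeasurable

lemma toReal_lrieszPotential_ae_eq {t : 𝔼 → ℝ} (ht : Measurable t) (ht0 : ∀ x, 0 ≤ t x)
    {U : HomSobolev d s} (h : IsDualFourier s t (fun ξ => (symbol s ξ : ℂ) * U.fourier ξ)) :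
    ∀ᵐ x, U x = (lrieszPotential (2 * s) t x).toReal := by
  have hVi := locallyIntegrable_toReal_lrieszPotential ht ht0 h
  have hUi : LocallyIntegrable (U : 𝔼 → ℝ) volume :=
    (Lp.memLp U.toLp).locallyIntegrable (sobolevExponent_ge_one hs.out)
  refine ae_eq_of_integral_contDiff_smul_eq hUi hVi fun g hg hc => ?_
  obtain ⟨R, hR⟩ := hc.isBounded.subset_closedBall 0
  obtain ⟨χ, hχ, hχc, hχ0, hχ1⟩ := exists_cutoff (d := d) R
  obtain ⟨M, hM⟩ := hg.continuous.bounded_above_of_compact_support hc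
  have hM0 : 0 ≤ M := (norm_nonneg _).trans (hM 0)
  -- a test function is the difference of the nonnegative test functions `g + M χ` and `M χ`
  have hp0 : ∀ x, 0 ≤ g x + M * χ x := by
    intro x
    by_cases hx : x ∈ tsupport g
    · rw [hχ1 x (hR hx), mul_one]
      linarith [neg_abs_le (g x), hM x, Real.norm_eq_abs (g x)]
    · rw [image_eq_zero_of_notMem_tsupport hx, zero_add]
      exact mul_nonneg hM0 (hχ0 x)
  have hMχ : ContDiff ℝ ∞ (fun x => M * χ x) := contDiff_const.mul hχ
  have hMχc : HasCompactSupport (fun x => M * χ x) := hχc.mul_left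
  have hp : ContDiff ℝ ∞ (fun x => g x + M * χ x) := hg.add hMχ
  have hpc : HasCompactSupport (fun x => g x + M * χ x) := hc.add hMχc
  have k1 := integral_lrieszPotential_mul_of_nonneg ht ht0 h hp hpc hp0
  have k2 := integral_lrieszPotential_mul_of_nonneg ht ht0 h hMχ hMχc
    (fun x => mul_nonneg hM0 (hχ0 x))
  have split : ∀ {V : 𝔼 → ℝ}, LocallyIntegrable V volume → ∫ y, g y • V y =
      (∫ y, (g y + M * χ y) * V y) - ∫ y, (M * χ y) * V y := by
    intro V hV
    rw [← integral_sub]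
    · congr 1
      ext y
      rw [smul_eq_mul]
      ring
    · exact hV.integrable_smul_left_of_hasCompactSupport hp.continuous hpc
    · exact hV.integrable_smul_left_of_hasCompactSupport hMχ.continuous hMχc
  rw [split hUi, split hVi, k1, k2]

/-- The energy identity for `t` itself. -/
lemma integral_potential_mul_self {t : 𝔼 → ℝ} (ht : Measurable t) (ht0 : ∀ x, 0 ≤ t x)
    {U : HomSobolev d s} (h : IsDualFourier s t (fun ξ => (symbol s ξ : ℂ) * U.fourier ξ)) :
    Integrable (fun x => rieszPotential (2 * s) t x * t x) volume ∧
      coulombEnergy (2 * s) t t = ‖U‖ ^ 2 := by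
  have hP := measurable_lrieszPotential (α := 2 * s) ht
  have e1 : linteraction (2 * s) t t = _ := h.lintegral_rieszKernel hs.out ht ht0
  have hE : ∫ ξ, (symbol s ξ)⁻¹ * ‖(symbol s ξ : ℂ) * U.fourier ξ‖ ^ 2 = ‖U‖ ^ 2 := by
    simp_rw [symbol_inv_mul_sq]
    rw [← HomSobolev.innerProd_self, ← HomSobolev.inner_eq, real_inner_self_eq_norm_sq]
  rw [hE, linteraction_eq_lintegral_potential hs.out] at e1
  have e2 : ∫⁻ x, ENNReal.ofReal ((lrieszPotential (2 * s) t x).toReal * t x) =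
      ENNReal.ofReal (‖U‖ ^ 2) := by
    rw [← e1]
    refine lintegral_congr_ae ?_
    filter_upwards [ae_lrieszPotential_lt_top ht ht0 h] with y hy
    rw [ENNReal.ofReal_mul ENNReal.toReal_nonneg, ENNReal.ofReal_toReal hy.ne]
  have hnn : 0 ≤ᵐ[volume] fun x => (lrieszPotential (2 * s) t x).toReal * t x :=
    ae_of_all _ fun x => mul_nonneg ENNReal.toReal_nonneg (ht0 x)
  have hm : AEStronglyMeasurable (fun x => (lrieszPotential (2 * s) t x).toReal * t x) volume :=
    (hP.ennreal_toReal.mul ht).aestronglyMeasurable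
  unfold coulombEnergy
  simp_rw [rieszPotential_eq_toReal hs.out ht ht0]
  refine ⟨⟨hm, ?_⟩, ?_⟩
  · rw [hasFiniteIntegral_iff_ofReal hnn, e2]
    exact ENNReal.ofReal_lt_top
  · rw [integral_eq_lintegral_of_nonneg_ae hnn hm, e2, ENNReal.toReal_ofReal (sq_nonneg _)]

lemma existsUnique_isRieszRepresentative (T : StrongDual ℝ (HomSobolev d s)) :
    ∃! U : HomSobolev d s, IsRieszRepresentative T U := by
  refine ⟨(InnerProductSpace.toDual ℝ (HomSobolev d s)).symm T, fun φ => ?_, fun V hV => ?_⟩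
  · exact (InnerProductSpace.toDual_symm_apply (𝕜 := ℝ)).symm
  · refine ext_inner_right ℝ fun φ => ?_
    rw [← hV φ, InnerProductSpace.toDual_symm_apply]

lemma norm_eq_of_isRieszRepresentative {T : StrongDual ℝ (HomSobolev d s)} {U : HomSobolev d s}
    (hU : IsRieszRepresentative T U) : ‖T‖ = ‖U‖ := by
  have : T = InnerProductSpace.toDual ℝ (HomSobolev d s) U := by
    ext φ
    rw [hU φ, InnerProductSpace.toDual_apply_apply]
  rw [this, LinearIsometryEquiv.norm_map]

lemma MemLqLoc.locallyIntegrable {q : ℝ≥0∞} (hq : 1 ≤ q) {t : 𝔼 → ℝ} (ht : MemLqLoc q t) :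
    LocallyIntegrable t volume := by
  rw [locallyIntegrable_iff]
  intro K hK
  have : IsFiniteMeasure (volume.restrict K) := ⟨by simpa using hK.measure_lt_top⟩
  exact (ht K hK).integrable hq

end Main

end RieszEnergy

end

theorem corollary5p3 (d : ℕ) (hd : 2 ≤ d) (s : ℝ) [hs : Fact (0 < s ∧ s < (d : ℝ) / 2)]
    (q : ℝ≥0∞) (hq : ENNReal.ofReal (2 * d / (d + 2 * s)) ≤ q)
    (T : StrongDual ℝ (RieszEnergy.HomSobolev d s)) (t : EuclideanSpace ℝ (Fin d) → ℝ)
    (ht : RieszEnergy.MemLqLoc q t) (hT : RieszEnergy.IsRegularDistribution T t)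
    (hpos : ∀ᵐ x, 0 ≤ t x) :
    -- the Riesz representative `U_T` exists and is unique
    (∃! U : RieszEnergy.HomSobolev d s, RieszEnergy.IsRieszRepresentative T U) ∧
    -- `I_{2s} * T` is an absolutely convergent integral a.e., and it equals `U_T` a.e.
    (∀ᵐ x, Integrable (fun y => RieszEnergy.rieszKernel (2 * s) (x - y) * t y)) ∧
    (∀ U : RieszEnergy.HomSobolev d s, RieszEnergy.IsRieszRepresentative T U →
      ∀ᵐ x, U x = RieszEnergy.rieszPotential (2 * s) t x) ∧
    -- the energy integral is finite and equals the squared dual norm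
    Integrable (fun x => RieszEnergy.rieszPotential (2 * s) t x * t x) ∧
    ‖T‖ ^ 2 = RieszEnergy.coulombEnergy (2 * s) t t := by
  have hs0 := hs.out.1
  have hs1 := hs.out.2
  have hq1 : 1 ≤ q := by
    refine le_trans ?_ hq
    rw [ENNReal.one_le_ofReal, le_div_iff₀] <;> linarith
  have htl := ht.locallyIntegrable hq1
  -- a nonnegative Borel representative of `t`
  obtain ⟨t', ht'm, ht't⟩ := htl.aestronglyMeasurable.aemeasurable
  obtain ⟨v, hvm, hv0, hvt⟩ : ∃ v : EuclideanSpace ℝ (Fin d) → ℝ, Measurable v ∧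
      (∀ x, 0 ≤ v x) ∧ t =ᵐ[volume] v := by
    refine ⟨fun x => max (t' x) 0, ht'm.max measurable_const, fun x => le_max_right _ _, ?_⟩
    filter_upwards [ht't, hpos] with x hx h0
    rw [← hx, max_eq_left h0]
  have hvl : LocallyIntegrable v volume := by
    intro x
    obtain ⟨K, hK, hi⟩ := htl x
    exact ⟨K, hK, hi.congr (ae_restrict_of_ae hvt)⟩
  have hTv : RieszEnergy.IsRegularDistribution T v := by
    intro φ hφ hc
    rw [hT φ hφ hc]
    refine integral_congr_ae ?_
    filter_upwards [hvt] with x hx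
    rw [hx]
  have hpot : RieszEnergy.rieszPotential (2 * s) t = RieszEnergy.rieszPotential (2 * s) v := by
    ext x
    refine integral_congr_ae ?_
    filter_upwards [hvt] with y hy
    rw [hy]
  obtain ⟨U, hU, huniq⟩ := RieszEnergy.existsUnique_isRieszRepresentative T
  have hdual := RieszEnergy.isDualFourier_of_isRieszRepresentative hvl hTv hU
  obtain ⟨hint, hen⟩ := RieszEnergy.integral_potential_mul_self hvm hv0 hdual
  have hae : (fun x => RieszEnergy.rieszPotential (2 * s) v x * v x) =ᵐ[volume]
      fun x => RieszEnergy.rieszPotential (2 * s) t x * t x := by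
    filter_upwards [hvt] with x hx
    rw [hpot, hx]
  refine ⟨⟨U, hU, huniq⟩, ?_, fun V hV => ?_, hint.congr hae, ?_⟩
  · filter_upwards [RieszEnergy.ae_lrieszPotential_lt_top hvm hv0 hdual] with x hx
    refine (RieszEnergy.integrable_rieszKernel_mul hs.out hvm hv0 hx).congr ?_
    filter_upwards [hvt] with y hy
    rw [hy]
  · obtain rfl := huniq V hV
    filter_upwards [RieszEnergy.toReal_lrieszPotential_ae_eq hvm hv0 hdual] with x hx
    rw [hx, hpot, RieszEnergy.rieszPotential_eq_toReal hs.out hvm hv0]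
  · rw [RieszEnergy.norm_eq_of_isRieszRepresentative hU, ← hen]
    exact integral_congr_ae hae
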